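/- **Conventions.** All $C^*$-algebras are unital (the zero algebra is allowed) and $*$-homomorphisms are unital. For a sequence $(a_n)$ of self-adjoint elements, $a_n \nearrow a$ means that $(a_n)$ is increasing with supremum $a$. A *$\sigma C^*$-algebra* is a $C^*$-algebra in which every norm-bounded increasing sequence of self-adjoint elements has a supremum; a positive map $\phi$ is *$\sigma$-normal* if $a_n \nearrow a$ implies $\phi(a_n) \nearrow \phi(a)$; a *$\sigma$-cpu map* is a $\sigma$-normal completely positive unital linear map; a *$\sigma$-homomorphism* is a $\sigma$-normal $*$-homomorphism. Let $\mathsf{c}\sigma\mathsf{C}^*_{\sigma\mathrm{cpu}}$ be the category of commutative $\sigma C^*$-algebras and $\sigma$-cpu maps, and consider its following full subcategories. - $\mathsf{cPureRep}\sigma\mathsf{C}^*_{\sigma\mathrm{cpu}}$: the purely $\sigma$-representable algebras $\mathcal A$, i.e. every $x \ge 0$ in $\mathcal A$ such that $\phi(x) = 0$ for all pure $\sigma$-states $\phi$ is zero. Here a pure $\sigma$-state is a $\sigma$-normal state that is an extreme point of the convex set of all states. - $\mathsf{cPedBaireC}^*_{\sigma\mathrm{cpu}}$: the commutative algebras $*$-isomorphic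 to the Pedersen–Baire envelope $\mathcal A^\infty$ of some $C^*$-algebra $\mathcal A$, and $\mathsf{cPedBaireSepC}^*_{\sigma\mathrm{cpu}}$: the same with $\mathcal A$ separable. Here $\mathcal A^\infty$ is the $\sigma$-closure of $\mathcal A$ in $\mathcal B(\mathcal H_u)$, where $\mathcal H_u$ is the space of the universal representation (equivalently, in $\mathcal A^{**}$), that is, the smallest linear subspace that contains $\mathcal A$, is closed under $*$, and contains $a$ whenever it contains all $a_n$ and $a_n \nearrow a$ in $\mathcal B(\mathcal H_u)$. Let $\mathsf{Stoch}$ be the category of measurable spaces and Markov kernels. Let $\mathsf{BaireStoch}$ and $\mathsf{StBorelStoch}$ be its full subcategories on the Baire measurable spaces (those whose $\sigma$-algebra is generated by the continuous real functions for some compact Hausdorff topology) and on the standard Borel spaces. For a measurable space $X$ let $\mathscr L^\infty(X)$ be the algebra of bounded measurable functions $X \to \mathbb C$, with pointwise operations and order and the supremum norm, and for a Markov kernel $\mu$ from $X$ to $Y$ let $\mathscr L^\infty(\mu) \colon \mathscr L^\infty(Y) \to \mathscr L^\infty(X)$ be the Koopman operator $$\mathscr L^\infty(\mu)(f)(x)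 = \int_Y f(y)\, d\mu(y \mid x).$$ For a commutative $\sigma C^*$-algebra $\mathcal A$ let $\mathrm{Spec}_\sigma(\mathcal A)$ be the set of $\sigma$-homomorphisms $\mathcal A \to \mathbb C$ with the smallest $\sigma$-algebra making all evaluations $\chi \mapsto \chi(a)$, $a \in \mathcal A$, measurable. **Proposition.** $\mathscr L^\infty$ is a fully faithful contravariant functor from $\mathsf{Stoch}$ to $\mathsf{c}\sigma\mathsf{C}^*_{\sigma\mathrm{cpu}}$, and all its values are purely $\sigma$-representable. On $\mathsf{cPureRep}\sigma\mathsf{C}^*_{\sigma\mathrm{cpu}}$, the assignment $\mathrm{Spec}_\sigma$ becomes a contravariant functor to $\mathsf{Stoch}$ which sends a $\sigma$-cpu map $\phi \colon \mathcal A \to \mathcal B$ to a Markov kernel $\kappa_\phi$ from $\mathrm{Spec}_\sigma(\mathcal B)$ to $\mathrm{Spec}_\sigma(\mathcal A)$ with $$\int \chi(a)\, d\kappa_\phi(\chi \mid \psi) = \psi(\phi(a)) \qquad (a \in \mathcal A,\ \psi \in \mathrm{Spec}_\sigma(\mathcal B)).$$ The functors $\mathscr L^\infty$ and $\mathrm{Spec}_\sigma$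 form a dual equivalence $$\mathsf{Stoch} \cong^{\mathrm{op}} \mathsf{cPureRep}\sigma\mathsf{C}^*_{\sigma\mathrm{cpu}}.$$ Moreover, $\mathsf{cPedBaireC}^*_{\sigma\mathrm{cpu}}$ and $\mathsf{cPedBaireSepC}^*_{\sigma\mathrm{cpu}}$ are contained in $\mathsf{cPureRep}\sigma\mathsf{C}^*_{\sigma\mathrm{cpu}}$, and the same two functors restrict to dual equivalences $$\mathsf{BaireStoch} \cong^{\mathrm{op}} \mathsf{cPedBaireC}^*_{\sigma\mathrm{cpu}}, \qquad \mathsf{StBorelStoch} \cong^{\mathrm{op}} \mathsf{cPedBaireSepC}^*_{\sigma\mathrm{cpu}}.$$ -/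

import Mathlib

open CategoryTheory MeasureTheory ProbabilityTheory
open scoped ComplexOrder CStarAlgebra ENNReal

universe u v

noncomputable section

/-- The bounded measurable functions `X → ℂ`, as a star subalgebra of the C⋆-algebra of all bounded
functions with the supremum norm. -/
def linfSubalgebra (X : Type u) [MeasurableSpace X] :
    StarSubalgebra ℂ (lp (fun _ : X => ℂ) ∞) where
  carrier := {f | Measurable (f : X → ℂ)}
  mul_mem' {f g} hf hg := by
    change Measurable (⇑(f * g))
    rw [lp.infty_coeFn_mul]; exact Measurable.mul hf hg
  add_mem' {f g} hf hg := by
    change Measurable (⇑(f + g))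
    rw [lp.coeFn_add]; exact Measurable.add hf hg
  algebraMap_mem' r := by
    change Measurable (fun _ : X => r)
    exact measurable_const
  star_mem' {f} hf := by
    change Measurable (⇑(star f))
    rw [lp.coeFn_star]
    exact (continuous_star.measurable : Measurable (star : ℂ → ℂ)).comp hf

instance isClosed_linfSubalgebra (X : Type u) [MeasurableSpace X] :
    IsClosed (linfSubalgebra X : Set (lp (fun _ : X => ℂ) ∞)) := by
  refine isSeqClosed_iff_isClosed.mp fun f g hf hg => ?_
  refine measurable_of_tendsto_metrizable hf (tendsto_pi_nhds.mpr fun x => ?_)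
  exact ((lp.lipschitzWith_one_eval (E := fun _ : X => ℂ) ∞ x).continuous.tendsto g).comp hg

/-- The commutative C⋆-algebra of bounded measurable functions `X → ℂ` (genuine functions, not
classes modulo null sets), with pointwise operations, pointwise order and supremum norm. -/
def Linf (X : Type u) [MeasurableSpace X] : Type u := linfSubalgebra X

namespace Linf

variable {X Y Z : Type u} [MeasurableSpace X] [MeasurableSpace Y] [MeasurableSpace Z]

instance : CommCStarAlgebra (Linf X) :=
  inferInstanceAs (CommCStarAlgebra (linfSubalgebra X))

instance : FunLike (Linf X) X ℂ where
  coe f := (f.1 : X → ℂ)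
  coe_injective _ _ h := Subtype.ext (lp.ext h)

@[ext] theorem ext {f g : Linf X} (h : ∀ x, f x = g x) : f = g := DFunLike.ext _ _ h

theorem measurable (f : Linf X) : Measurable f := f.2

theorem norm_apply_le (f : Linf X) (x : X) : ‖f x‖ ≤ ‖f‖ :=
  lp.norm_apply_le_norm (E := fun _ : X => ℂ) ENNReal.top_ne_zero f.1 x

theorem norm_le {f : Linf X} {C : ℝ} (hC : 0 ≤ C) (h : ∀ x, ‖f x‖ ≤ C) : ‖f‖ ≤ C :=
  lp.norm_le_of_forall_le (E := fun _ : X => ℂ) hC h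

/-- A bounded measurable function as an element of `Linf X`. -/
def mk (f : X → ℂ) (hf : Measurable f) (C : ℝ) (hC : ∀ x, ‖f x‖ ≤ C) : Linf X :=
  ⟨⟨f, memℓp_infty ⟨C, by rintro _ ⟨x, rfl⟩; exact hC x⟩⟩, hf⟩

@[simp] theorem mk_apply (f : X → ℂ) (hf : Measurable f) (C : ℝ) (hC : ∀ x, ‖f x‖ ≤ C) (x : X) :
    mk f hf C hC x = f x := rfl
@[simp] theorem add_apply (f g : Linf X) (x : X) : (f + g) x = f x + g x := rfl
@[simp] theorem sub_apply (f g : Linf X) (x : X) : (f - g) x = f x - g x := rfl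
@[simp] theorem mul_apply (f g : Linf X) (x : X) : (f * g) x = f x * g x := rfl
@[simp] theorem star_apply (f : Linf X) (x : X) : (star f) x = star (f x) := rfl
@[simp] theorem smul_apply (c : ℂ) (f : Linf X) (x : X) : (c • f) x = c * f x := rfl
@[simp] theorem one_apply (x : X) : (1 : Linf X) x = 1 := rfl
@[simp] theorem zero_apply (x : X) : (0 : Linf X) x = 0 := rfl

instance : PartialOrder (Linf X) where
  le f g := ∀ x, f x ≤ g x
  le_refl f x := le_refl _
  le_trans f g h h₁ h₂ x := (h₁ x).trans (h₂ x)
  le_antisymm f g h₁ h₂ := ext fun x => le_antisymm (h₁ x) (h₂ x)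

theorem le_def {f g : Linf X} : f ≤ g ↔ ∀ x, f x ≤ g x := Iff.rfl

instance : StarOrderedRing (Linf X) := by
  refine StarOrderedRing.of_le_iff fun f g => ⟨fun h => ?_, ?_⟩
  · refine ⟨mk (fun x => (Real.sqrt (g x - f x).re : ℂ)) ?_ (Real.sqrt ‖g - f‖) ?_, ?_⟩
    · have h1 := g.measurable
      have h2 := f.measurable
      fun_prop
    · intro x
      rw [Complex.norm_real, Real.norm_of_nonneg (Real.sqrt_nonneg _)]
      exact Real.sqrt_le_sqrt ((Complex.re_le_norm _).trans (norm_apply_le (g - f) x))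
    · ext x
      have h0 := Complex.le_def.mp (sub_nonneg.mpr (h x))
      have h1 : ((Real.sqrt (g x - f x).re : ℂ)) * (Real.sqrt (g x - f x).re : ℂ) = g x - f x := by
        rw [← Complex.ofReal_mul, Real.mul_self_sqrt h0.1]
        exact Complex.ext rfl h0.2
      rw [add_apply, mul_apply, star_apply, mk_apply]
      simp only [Complex.star_def, Complex.conj_ofReal, h1, add_sub_cancel]
  · rintro ⟨s, rfl⟩ x
    simpa using star_mul_self_nonneg (s x)

/-- Point evaluation as a star homomorphism. -/
def eval (x : X) : Linf X →⋆ₐ[ℂ] ℂ where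
  toFun f := f x
  map_one' := rfl
  map_mul' _ _ := rfl
  map_zero' := rfl
  map_add' _ _ := rfl
  commutes' _ := rfl
  map_star' _ := rfl

/-- Entrywise point evaluation of matrices over `Linf X`. -/
def evalMatrix (k : ℕ) (x : X) :
    CStarMatrix (Fin k) (Fin k) (Linf X) →⋆ₙₐ[ℂ] CStarMatrix (Fin k) (Fin k) ℂ :=
  CStarMatrix.mapₙₐ (NonUnitalStarAlgHomClass.toNonUnitalStarAlgHom (eval x))

theorem evalMatrix_apply (k : ℕ) (x : X) (M : CStarMatrix (Fin k) (Fin k) (Linf X)) (i j : Fin k) :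
    evalMatrix k x M i j = M i j x := rfl


/-- Positivity is detected by a jointly injective family of star homomorphisms. -/
theorem nonneg_of_forall_map {D E : Type*} {ι : Sort*} [NonUnitalCStarAlgebra D] [PartialOrder D]
    [StarOrderedRing D] [NonUnitalCStarAlgebra E] [PartialOrder E] [StarOrderedRing E]
    (φ : ι → D →⋆ₙₐ[ℂ] E) (hφ : ∀ a, (∀ i, φ i a = 0) → a = 0) {a : D} (ha : IsSelfAdjoint a)
    (h : ∀ i, 0 ≤ φ i a) : 0 ≤ a := by
  rw [← CFC.negPart_eq_zero_iff a ha]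
  refine hφ _ fun i => ?_
  have hi := (CFC.negPart_eq_zero_iff (φ i a) (IsSelfAdjoint.of_nonneg (h i))).mpr (h i)
  rw [CFC.negPart_def] at hi ⊢
  rw [← hi]
  exact NonUnitalStarAlgHomClass.map_cfcₙ (S := ℂ) (φ i) (fun x : ℝ => x⁻) a
    (hφ := map_continuous (φ i)) (hφa := IsSelfAdjoint.of_nonneg (h i))

theorem exists_star_mul_self {D : Type*} [NonUnitalCStarAlgebra D] [PartialOrder D]
    [StarOrderedRing D] {a : D} (ha : 0 ≤ a) : ∃ b, a = star b * b :=
  CStarAlgebra.nonneg_iff_eq_star_mul_self.mp ha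

/-- A matrix over `Linf X` is positive as soon as it is pointwise positive. -/
theorem matrix_nonneg {k : ℕ} {M : CStarMatrix (Fin k) (Fin k) (Linf X)}
    (h : ∀ x, 0 ≤ evalMatrix k x M) : 0 ≤ M := by
  refine nonneg_of_forall_map (evalMatrix k) (fun a ha => ?_) ?_ h
  · exact CStarMatrix.ext fun i j => Linf.ext fun x => congrArg (fun N => N i j) (ha x)
  · exact CStarMatrix.ext fun i j => Linf.ext fun x =>
      congrArg (fun N => N i j) (IsSelfAdjoint.of_nonneg (h x)).star_eq

open scoped MatrixOrder in
theorem matrix_nonneg_complex {k : ℕ} {M : CStarMatrix (Fin k) (Fin k) ℂ} (hM : IsSelfAdjoint M)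
    (h : ∀ v : Fin k → ℂ, 0 ≤ ∑ i, ∑ j, star (v i) * M i j * v j) : 0 ≤ M := by
  have h1 : Matrix.PosSemidef (CStarMatrix.ofMatrix.symm M) := by
    refine Matrix.PosSemidef.of_dotProduct_mulVec_nonneg hM fun v => ?_
    refine (h v).trans_eq ?_
    simp [dotProduct, Matrix.mulVec, Finset.mul_sum, mul_assoc]
  exact map_nonneg (CStarMatrix.ofMatrixStarAlgEquiv (n := Fin k) (A := ℂ)) h1.nonneg


theorem matrix_quadratic_nonneg {k : ℕ} {M : CStarMatrix (Fin k) (Fin k) (Linf X)} (hM : 0 ≤ M)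
    (x : X) (v : Fin k → ℂ) : 0 ≤ ∑ i, ∑ j, star (v i) * M i j x * v j := by
  obtain ⟨N, rfl⟩ := exists_star_mul_self hM
  have h1 : ∀ i j, (star N * N : CStarMatrix (Fin k) (Fin k) (Linf X)) i j x
      = ∑ l, star (N l i x) * N l j x := fun i j => by
    rw [CStarMatrix.mul_apply]
    exact map_sum (eval x) _ _
  have h2 : ∑ i, ∑ j, star (v i) * (star N * N : CStarMatrix (Fin k) (Fin k) (Linf X)) i j x * v j
      = ∑ l, star (∑ i, N l i x * v i) * (∑ i, N l i x * v i) := by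
    simp_rw [h1, star_sum, Finset.sum_mul_sum, Finset.mul_sum, Finset.sum_mul]
    rw [Finset.sum_comm_cycle]
    refine Finset.sum_congr rfl fun l _ => Finset.sum_congr rfl fun i _ =>
      Finset.sum_congr rfl fun j _ => ?_
    simp only [star_mul]
    ring
  refine le_of_le_of_eq ?_ h2.symm
  exact Finset.sum_nonneg fun l _ => star_mul_self_nonneg _

theorem integrable (f : Linf X) (μ : Measure X) [IsFiniteMeasure μ] : Integrable f μ :=
  Integrable.of_bound f.measurable.aestronglyMeasurable ‖f‖ (ae_of_all _ f.norm_apply_le)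

/-- The Koopman operator of a Markov kernel `κ`: `f ↦ (x ↦ ∫ f dκ(x))`. -/
def koopmanFun (κ : Kernel X Y) [IsMarkovKernel κ] (f : Linf Y) : Linf X :=
  mk (fun x => ∫ y, f y ∂(κ x)) f.measurable.stronglyMeasurable.integral_kernel.measurable ‖f‖
    fun x => (norm_integral_le_of_norm_le_const (ae_of_all _ f.norm_apply_le)).trans_eq (by simp)

@[simp] theorem koopmanFun_apply (κ : Kernel X Y) [IsMarkovKernel κ] (f : Linf Y) (x : X) :
    koopmanFun κ f x = ∫ y, f y ∂(κ x) := rfl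

/-- The Koopman operator is completely positive. -/
def koopmanCP (κ : Kernel X Y) [IsMarkovKernel κ] : Linf Y →CP Linf X where
  toFun := koopmanFun κ
  map_add' f g := ext fun x => integral_add (f.integrable _) (g.integrable _)
  map_smul' c f := ext fun x => integral_const_mul c _
  map_cstarMatrix_nonneg' k M hM := by
    refine matrix_nonneg fun x => matrix_nonneg_complex ?_ fun v => ?_
    · refine CStarMatrix.ext fun i j => ?_
      have h := congrArg (fun N => N i j) (IsSelfAdjoint.of_nonneg hM).star_eq
      change star (∫ y, M j i y ∂(κ x)) = ∫ y, M i j y ∂(κ x)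
      have h' : ∀ y, M i j y = star (M j i y) := fun y => congrArg (fun f : Linf Y => f y) h.symm
      simp_rw [h']
      exact integral_conj.symm
    · have h : ∑ i, ∑ j, star (v i) * (evalMatrix k x (M.map (koopmanFun κ))) i j * v j
          = ∫ y, ∑ i, ∑ j, star (v i) * M i j y * v j ∂(κ x) := by
        rw [integral_finsetSum]
        · refine Finset.sum_congr rfl fun i _ => ?_
          rw [integral_finsetSum]
          · refine Finset.sum_congr rfl fun j _ => ?_
            rw [integral_mul_const, integral_const_mul]
            rfl
          · exact fun j _ => (((M i j).integrable _).const_mul _).mul_const _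
        · exact fun i _ => integrable_finsetSum _ fun j _ =>
            (((M i j).integrable _).const_mul _).mul_const _
      refine le_of_le_of_eq ?_ h.symm
      exact integral_nonneg fun y => matrix_quadratic_nonneg hM y v


end Linf

section SigmaNotions

variable {A : Type u} {B : Type v}

/-- `(a n) ↗ s`: an increasing sequence of self-adjoint elements with supremum `s`. Such a sequence is
automatically norm bounded, since `a 0 ≤ a n ≤ s`. Every upper bound of a self-adjoint element is
self-adjoint, so the supremum in the algebra is the supremum in its self-adjoint part. -/
structure IncreasesTo [CStarAlgebra A] [PartialOrder A] (a : ℕ → A) (s : A) : Prop where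
  isSelfAdjoint : ∀ n, IsSelfAdjoint (a n)
  monotone : Monotone a
  isLUB : IsLUB (Set.range a) s

/-- The σC⋆-condition: every norm-bounded increasing sequence of self-adjoint elements has a
supremum. -/
def IsSigmaComplete (A : Type u) [CStarAlgebra A] [PartialOrder A] : Prop :=
  ∀ a : ℕ → A, (∀ n, IsSelfAdjoint (a n)) → Monotone a → (∃ C : ℝ, ∀ n, ‖a n‖ ≤ C) →
    ∃ s, IncreasesTo a s

/-- σ-normality: preservation of suprema of increasing sequences. -/
def IsSigmaNormal [CStarAlgebra A] [PartialOrder A] [Preorder B] (φ : A → B) : Prop :=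
  ∀ (a : ℕ → A) (s : A), IncreasesTo a s → IsLUB (Set.range fun n => φ (a n)) (φ s)

end SigmaNotions

namespace Linf

variable {X Y Z : Type u} [MeasurableSpace X] [MeasurableSpace Y] [MeasurableSpace Z]

theorem exists_pointwise_sup (a : ℕ → Linf X) (hsa : ∀ n, IsSelfAdjoint (a n)) (hmono : Monotone a)
    (hb : ∃ C : ℝ, ∀ n, ‖a n‖ ≤ C) :
    ∃ s : Linf X, IsLUB (Set.range a) s ∧ 
      ∀ x, Filter.Tendsto (fun n => a n x) Filter.atTop (nhds (s x)) := by
  obtain ⟨C, hC⟩ := hb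
  have hre : ∀ n x, a n x = ((a n x).re : ℂ) := fun n x =>
    (Complex.conj_eq_iff_re.mp (congrArg (fun f : Linf X => f x) (hsa n).star_eq)).symm
  have hm : ∀ x, Monotone fun n => (a n x).re := fun x i j h =>
    (Complex.le_def.mp (hmono h x)).1
  have hbd : ∀ n x, |(a n x).re| ≤ C := fun n x =>
    (Complex.abs_re_le_norm _).trans (((a n).norm_apply_le x).trans (hC n))
  have hbdd : ∀ x, BddAbove (Set.range fun n => (a n x).re) := fun x =>
    ⟨C, by rintro _ ⟨n, rfl⟩; exact (abs_le.mp (hbd n x)).2⟩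
  let s : Linf X := mk (fun x => ((⨆ n, (a n x).re : ℝ) : ℂ))
    (Complex.measurable_ofReal.comp
      (Measurable.iSup fun n => Complex.measurable_re.comp (a n).measurable)) C
    (fun x => by
      rw [Complex.norm_real, Real.norm_eq_abs, abs_le]
      exact ⟨(abs_le.mp (hbd 0 x)).1.trans (le_ciSup (hbdd x) 0),
        ciSup_le fun n => (abs_le.mp (hbd n x)).2⟩)
  refine ⟨s, ⟨?_, ?_⟩, fun x => ?_⟩
  · rintro _ ⟨n, rfl⟩ x
    rw [hre n x]
    exact Complex.real_le_real.mpr (le_ciSup (hbdd x) n)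
  · intro g hg x
    have h1 : ∀ n, (a n x).re ≤ (g x).re ∧ (a n x).im = (g x).im := fun n =>
      Complex.le_def.mp (hg ⟨n, rfl⟩ x)
    refine Complex.le_def.mpr ⟨ciSup_le fun n => (h1 n).1, ?_⟩
    rw [← (h1 0).2, hre 0 x]
    rfl
  · have := (Complex.continuous_ofReal.tendsto _).comp (tendsto_atTop_ciSup (hm x) (hbdd x))
    exact this.congr fun n => (hre n x).symm

theorem isSigmaComplete : IsSigmaComplete (Linf X) := fun a hsa hmono hb => by
  obtain ⟨s, hs, -⟩ := exists_pointwise_sup a hsa hmono hb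
  exact ⟨s, hsa, hmono, hs⟩

theorem norm_le_of_increasesTo {a : ℕ → Linf X} {s : Linf X} (h : IncreasesTo a s) (n : ℕ) :
    ‖a n‖ ≤ ‖a 0‖ + ‖s‖ := by
  refine norm_le (by positivity) fun y => ?_
  have h0 := Complex.le_def.mp (h.monotone (Nat.zero_le n) y)
  have h1 := Complex.le_def.mp (h.isLUB.1 ⟨n, rfl⟩ y)
  have hre : a n y = ((a n y).re : ℂ) :=
    (Complex.conj_eq_iff_re.mp (congrArg (fun f : Linf X => f y) (h.isSelfAdjoint n).star_eq)).symm
  rw [hre, Complex.norm_real, Real.norm_eq_abs, abs_le]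
  have h2 := abs_le.mp ((Complex.abs_re_le_norm _).trans ((a 0).norm_apply_le y))
  have h3 := abs_le.mp ((Complex.abs_re_le_norm _).trans (s.norm_apply_le y))
  constructor <;> linarith [h0.1, h1.1, h2.1, h3.2, norm_nonneg (a 0), norm_nonneg s]

theorem tendsto_of_increasesTo {a : ℕ → Linf X} {s : Linf X} (h : IncreasesTo a s) (x : X) :
    Filter.Tendsto (fun n => a n x) Filter.atTop (nhds (s x)) := by
  obtain ⟨t, ht, h'⟩ := exists_pointwise_sup a h.isSelfAdjoint h.monotone
    ⟨_, norm_le_of_increasesTo h⟩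
  rw [h.isLUB.unique ht]
  exact h' x

theorem isSigmaNormal_koopmanFun (κ : Kernel X Y) [IsMarkovKernel κ] :
    IsSigmaNormal (koopmanFun κ) := by
  intro a s h
  have hle : ∀ n, koopmanFun κ (a n) ≤ koopmanFun κ s := fun n x =>
    integral_mono ((a n).integrable _) (s.integrable _) (h.isLUB.1 ⟨n, rfl⟩)
  have hlim : ∀ x, Filter.Tendsto (fun n => koopmanFun κ (a n) x) Filter.atTop
      (nhds (koopmanFun κ s x)) := fun x =>
    tendsto_integral_of_dominated_convergence (fun _ => ‖a 0‖ + ‖s‖)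
      (fun n => (a n).measurable.aestronglyMeasurable) (integrable_const _)
      (fun n => ae_of_all _ fun y => ((a n).norm_apply_le y).trans (norm_le_of_increasesTo h n))
      (ae_of_all _ fun y => tendsto_of_increasesTo h y)
  refine ⟨by rintro _ ⟨n, rfl⟩; exact hle n, fun g hg x => ?_⟩
  exact le_of_tendsto' (hlim x) fun n => hg ⟨n, rfl⟩ x

end Linf

/-- σ-cpu maps: completely positive, unital, σ-normal (complex linear) maps. -/
structure SigmaCPUMap (A : Type u) (B : Type v) [CStarAlgebra A] [PartialOrder A]
    [StarOrderedRing A] [CStarAlgebra B] [PartialOrder B] [StarOrderedRing B]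
    extends CompletelyPositiveMap A B where
  map_one' : toFun 1 = 1
  isSigmaNormal' : IsSigmaNormal toFun

namespace SigmaCPUMap

variable {A B C : Type*} [CStarAlgebra A] [PartialOrder A] [StarOrderedRing A]
  [CStarAlgebra B] [PartialOrder B] [StarOrderedRing B]
  [CStarAlgebra C] [PartialOrder C] [StarOrderedRing C]

instance : FunLike (SigmaCPUMap A B) A B where
  coe φ := φ.toCompletelyPositiveMap
  coe_injective φ ψ h := by
    cases φ; cases ψ
    congr
    exact DFunLike.coe_injective h

@[ext] theorem ext {φ ψ : SigmaCPUMap A B} (h : ∀ a, φ a = ψ a) : φ = ψ := DFunLike.ext _ _ h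

theorem increasesTo (φ : SigmaCPUMap A B) {a : ℕ → A} {s : A} (h : IncreasesTo a s) :
    IncreasesTo (fun n => φ (a n)) (φ s) where
  isSelfAdjoint n :=
    (map_star (PositiveLinearMap.ofClass φ.toCompletelyPositiveMap) (a n)).symm.trans
      (congrArg φ (h.isSelfAdjoint n).star_eq)
  monotone := (OrderHomClass.mono φ.toCompletelyPositiveMap).comp h.monotone
  isLUB := φ.isSigmaNormal' a s h

/-- The identity. -/
protected def id (A : Type*) [CStarAlgebra A] [PartialOrder A] [StarOrderedRing A] :
    SigmaCPUMap A A where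
  toLinearMap := LinearMap.id
  map_cstarMatrix_nonneg' _ _ hM := hM
  map_one' := rfl
  isSigmaNormal' _ _ h := h.isLUB

/-- Composition. -/
def comp (ψ : SigmaCPUMap B C) (φ : SigmaCPUMap A B) : SigmaCPUMap A C where
  toLinearMap := ψ.toLinearMap ∘ₗ φ.toLinearMap
  map_cstarMatrix_nonneg' k M hM :=
    ψ.map_cstarMatrix_nonneg' k _ (φ.map_cstarMatrix_nonneg' k M hM)
  map_one' := (congrArg ψ φ.map_one').trans ψ.map_one'
  isSigmaNormal' _ _ h := ψ.isSigmaNormal' _ _ (φ.increasesTo h)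

end SigmaCPUMap

/-- Commutative σC⋆-algebras. The order is the C⋆-algebra order: `StarOrderedRing` forces it. Morphisms
are the σ-cpu maps. The zero algebra is allowed (it corresponds to the empty space). -/
structure CommSigmaCStar : Type (u + 1) where
  carrier : Type u
  [commCStarAlgebra : CommCStarAlgebra carrier]
  [partialOrder : PartialOrder carrier]
  [starOrderedRing : StarOrderedRing carrier]
  isSigmaComplete : IsSigmaComplete carrier

namespace CommSigmaCStar

instance : CoeSort CommSigmaCStar.{u} (Type u) := ⟨carrier⟩
attribute [instance] commCStarAlgebra partialOrder starOrderedRing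

instance : Category CommSigmaCStar.{u} where
  Hom A B := SigmaCPUMap A B
  id A := SigmaCPUMap.id A
  comp φ ψ := SigmaCPUMap.comp ψ φ

instance (A B : CommSigmaCStar.{u}) : FunLike (A ⟶ B) A B :=
  inferInstanceAs (FunLike (SigmaCPUMap A B) A B)

end CommSigmaCStar

/-- The Koopman operator as a σ-cpu map. -/
def koopmanMap {X Y : Type u} [MeasurableSpace X] [MeasurableSpace Y] (κ : Kernel X Y)
    [IsMarkovKernel κ] : SigmaCPUMap (Linf Y) (Linf X) where
  toCompletelyPositiveMap := Linf.koopmanCP κ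
  map_one' := Linf.ext fun x => by
    change ∫ _, (1 : ℂ) ∂(κ x) = 1
    simp
  isSigmaNormal' := Linf.isSigmaNormal_koopmanFun κ

/-- The Markov kernel underlying a morphism of `Stoch`, the category of measurable spaces and Markov
kernels. -/
abbrev stochKernel {X Y : Stoch.{u}} (κ : X ⟶ Y) : Kernel X.obj Y.obj := κ.hom.hom

/-- The contravariant functor from Markov kernels to commutative σC⋆-algebras with σ-cpu maps: it sends
`X` to the bounded measurable functions on `X` and a Markov kernel to its Koopman operator. -/
def koopman : Stoch.{u}ᵒᵖ ⥤ CommSigmaCStar.{u} where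
  obj X := { carrier := Linf X.unop.obj, isSigmaComplete := Linf.isSigmaComplete }
  map κ := koopmanMap (stochKernel κ.unop)
  map_id X := SigmaCPUMap.ext fun f => Linf.ext fun x => by
    change ∫ y, f y ∂(Kernel.id x) = f x
    rw [Kernel.id_apply, integral_dirac' _ _ f.measurable.stronglyMeasurable]
  map_comp {X Y Z} κ μ := SigmaCPUMap.ext fun f => Linf.ext fun x => by
    exact Kernel.integral_comp (f.integrable ((stochKernel κ.unop ∘ₖ stochKernel μ.unop) x))

section PureStates

variable (A : Type u) [CStarAlgebra A] [PartialOrder A]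

/-- The convex set of states: positive unital linear functionals. -/
def states : Set (A →ₗ[ℂ] ℂ) := {φ | (∀ a, 0 ≤ a → 0 ≤ φ a) ∧ φ 1 = 1}

/-- Pure σ-states: σ-normal states which are extreme in the set of all states. -/
def pureSigmaStates : Set (A →ₗ[ℂ] ℂ) :=
  {φ | φ ∈ (states A).extremePoints ℝ ∧ IsSigmaNormal φ}

/-- The pure σ-states separate the positive elements from zero. -/
def IsPurelySigmaRepresentable : Prop :=
  ∀ x : A, 0 ≤ x → (∀ φ ∈ pureSigmaStates A, φ x = 0) → x = 0

end PureStates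

section UniversalRepresentation

/-- The Hilbert space of the universal representation: the Hilbert sum of the GNS spaces of all
states of `A`. -/
abbrev UnivHilbert (A : Type u) [CStarAlgebra A] [PartialOrder A] [StarOrderedRing A] : Type u :=
  lp (fun φ : {φ : A →ₚ[ℂ] ℂ // φ 1 = 1} => φ.1.GNS) 2

variable {A : Type u} [CStarAlgebra A] [PartialOrder A] [StarOrderedRing A]

/-- The action of `a` on the Hilbert sum: in each summand, its GNS representation. -/
def universalRepFun (a : A) : UnivHilbert A →L[ℂ] UnivHilbert A :=
  lp.mapCLM 2 (fun φ : {φ : A →ₚ[ℂ] ℂ // φ 1 = 1} => φ.1.gnsStarAlgHom a) (norm_nonneg a)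
    fun φ => NonUnitalStarAlgHom.norm_apply_le φ.1.gnsStarAlgHom a

theorem universalRepFun_apply (a : A) (ξ : UnivHilbert A) (φ : {φ : A →ₚ[ℂ] ℂ // φ 1 = 1}) :
    universalRepFun a ξ φ = φ.1.gnsStarAlgHom a (ξ φ) := rfl

variable (A) in
/-- The universal representation of `A`: the direct sum of the GNS representations of all states. -/
def universalRep : A →⋆ₐ[ℂ] (UnivHilbert A →L[ℂ] UnivHilbert A) where
  toFun := universalRepFun
  map_one' := ContinuousLinearMap.ext fun ξ => lp.ext <| funext fun φ => by
    rw [universalRepFun_apply, map_one]; rfl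
  map_mul' a b := ContinuousLinearMap.ext fun ξ => lp.ext <| funext fun φ => by
    rw [universalRepFun_apply, map_mul]; rfl
  map_zero' := ContinuousLinearMap.ext fun ξ => lp.ext <| funext fun φ => by
    rw [universalRepFun_apply, map_zero]; rfl
  map_add' a b := ContinuousLinearMap.ext fun ξ => lp.ext <| funext fun φ => by
    rw [universalRepFun_apply, map_add]; rfl
  commutes' r := ContinuousLinearMap.ext fun ξ => lp.ext <| funext fun φ => by
    rw [universalRepFun_apply, AlgHomClass.commutes]; rfl
  map_star' a := by
    refine (ContinuousLinearMap.eq_adjoint_iff _ _).mpr fun ξ η => ?_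
    rw [lp.inner_eq_tsum, lp.inner_eq_tsum]
    refine tsum_congr fun φ => ?_
    rw [universalRepFun_apply, universalRepFun_apply, map_star]
    exact ContinuousLinearMap.adjoint_inner_left _ _ _
end UniversalRepresentation

section PedersenBaire

/-- The smallest linear subspace which contains `W`, is closed under the involution, and is σ-closed:
it contains the supremum of each increasing sequence of its elements. The supremum is that of `B`. -/
def sigmaClosure {B : Type u} [CStarAlgebra B] [PartialOrder B] (W : Set B) : Set B :=
  {b | ∀ V : Submodule ℂ B, W ⊆ V → (∀ x ∈ V, star x ∈ V) →
    (∀ (a : ℕ → B) (s : B), (∀ n, a n ∈ V) → IncreasesTo a s → s ∈ V) → b ∈ V}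

/-- `B` is (isomorphic as a unital star algebra to) the Pedersen–Baire envelope of `A`: the σ-closure
of `A` in the algebra of bounded operators on the Hilbert space of its universal representation.
Operators carry the Loewner order. -/
def IsPedersenBaireEnvelope (A : Type u) [CStarAlgebra A] [PartialOrder A] [StarOrderedRing A]
    (B : Type v) [CStarAlgebra B] : Prop :=
  ∃ ι : B →⋆ₐ[ℂ] (UnivHilbert A →L[ℂ] UnivHilbert A),
    Function.Injective ι ∧ Set.range ι = sigmaClosure (Set.range (universalRep A))

end PedersenBaire

namespace CommSigmaCStar

/-- Purely σ-representable algebras. -/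
def isPure : ObjectProperty CommSigmaCStar.{u} := fun A => IsPurelySigmaRepresentable A

/-- Commutative Pedersen–Baire envelopes. -/
def isPedBaire : ObjectProperty CommSigmaCStar.{u} := fun B =>
  ∃ (A : Type u) (_ : CStarAlgebra A) (_ : PartialOrder A) (_ : StarOrderedRing A),
    IsPedersenBaireEnvelope A B

/-- Commutative Pedersen–Baire envelopes of separable C⋆-algebras. -/
def isPedBaireSep : ObjectProperty CommSigmaCStar.{u} := fun B =>
  ∃ (A : Type u) (_ : CStarAlgebra A) (_ : PartialOrder A) (_ : StarOrderedRing A),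
    TopologicalSpace.SeparableSpace A ∧ IsPedersenBaireEnvelope A B

end CommSigmaCStar

/-- The Gelfand σ-spectrum: the σ-normal unital star homomorphisms to `ℂ`. -/
def SigmaSpectrum (A : Type u) [CStarAlgebra A] [PartialOrder A] : Type u :=
  {χ : A →⋆ₐ[ℂ] ℂ // IsSigmaNormal χ}

/-- The smallest σ-algebra making the evaluations measurable. -/
instance (A : Type u) [CStarAlgebra A] [PartialOrder A] : MeasurableSpace (SigmaSpectrum A) :=
  ⨆ a : A, (borel ℂ).comap fun χ => χ.1 a

/-- The Gelfand σ-spectrum as an object of `Stoch`. -/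
def specStoch (A : CommSigmaCStar.{u}) : Stoch.{u} := ⟨SFinKer.of (SigmaSpectrum A)⟩

/-- A functorial (contravariant) action of the Gelfand σ-spectrum on σ-cpu maps between purely
σ-representable algebras: `φ : A ⟶ B` gives a Markov kernel from the spectrum of `B` to that of `A`
which sends `ψ` to a probability measure representing the state `ψ ∘ φ`. The existence of such an
action is never assumed below: it is part of what is asserted. Since the evaluations generate the
σ-algebra, the formula for the integrals determines `map`. -/
structure SpecAction where
  map {A B : CommSigmaCStar.isPure.{u}.FullSubcategory} (φ : A ⟶ B) :
    specStoch B.obj ⟶ specStoch A.obj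
  map_id (A : CommSigmaCStar.isPure.{u}.FullSubcategory) : map (𝟙 A) = 𝟙 (specStoch A.obj)
  map_comp {A B C : CommSigmaCStar.isPure.{u}.FullSubcategory} (φ : A ⟶ B) (ψ : B ⟶ C) :
    map (φ ≫ ψ) = map ψ ≫ map φ
  integral_map {A B : CommSigmaCStar.isPure.{u}.FullSubcategory} (φ : A ⟶ B)
    (ψ : SigmaSpectrum B.obj) (a : A.obj) :
    ∫ χ : SigmaSpectrum A.obj, χ.1 a ∂(stochKernel (map φ) ψ) = ψ.1 (φ.hom a)

/-- The resulting functor. -/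
def SpecAction.functor (S : SpecAction.{u}) :
    CommSigmaCStar.isPure.{u}.FullSubcategoryᵒᵖ ⥤ Stoch.{u} where
  obj A := specStoch A.unop.obj
  map φ := S.map φ.unop
  map_id A := S.map_id A.unop
  map_comp φ ψ := S.map_comp ψ.unop φ.unop

/-- The σ-algebra is the Baire σ-algebra of some compact Hausdorff topology, i.e. the smallest one
making all continuous functions `X → ℝ` measurable. -/
def IsBaireMeasurableSpace (X : Type u) [m : MeasurableSpace X] : Prop :=
  ∃ _ : TopologicalSpace X, CompactSpace X ∧ T2Space X ∧ m = ⨆ f : C(X, ℝ), (borel ℝ).comap f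

/-- The objects of the full subcategory `BaireStoch`. -/
def isBaire : ObjectProperty Stoch.{u} := fun X => IsBaireMeasurableSpace X.obj

/-- The objects of the full subcategory `StBorelStoch`. -/
def isStandardBorel : ObjectProperty Stoch.{u} := fun X => StandardBorelSpace X.obj

/-- `koopman` and the spectrum functor restrict to mutually inverse contravariant equivalences between
the full subcategory `P` of `Stoch` and the full subcategory `Q` of purely σ-representable algebras:
`Q` consists of purely σ-representable algebras, `koopman` maps `P` into `Q`, the spectrum maps `Q`
into `P`, and the two restrictions are the two functors of an equivalence of categories. -/
def RestrictsToDuality (P : ObjectProperty Stoch.{u}) (Q : ObjectProperty CommSigmaCStar.{u})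
    (S : SpecAction.{u}) : Prop :=
  ∃ (hQ : Q ≤ CommSigmaCStar.isPure)
    (hL : ∀ X : P.FullSubcategoryᵒᵖ, Q (koopman.obj (.op X.unop.obj)))
    (hS : ∀ A : Q.FullSubcategoryᵒᵖ, P (specStoch A.unop.obj))
    (e : P.FullSubcategoryᵒᵖ ≌ Q.FullSubcategory),
    e.functor = Q.lift (P.ι.op ⋙ koopman) hL ∧
    e.inverse = (P.lift ((ObjectProperty.ιOfLE hQ).op ⋙ S.functor) hS).rightOp

end

noncomputable section

open Filter Topology

/-! A monotone class argument drives everything: a σ-closed subspace of `Linf X` that contains the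
constants and enough functions to generate the σ-algebra is the whole algebra
(`Linf.eq_top_of_isPiSystem`, `Linf.eq_top_of_generating`). Hence σ-normal linear maps on `Linf X`
that agree on generators agree everywhere.

The Koopman functor is fully faithful because, for a σ-cpu map φ and a point x, the set function E ↦
φ(1_E)(x) is countably additive by σ-normality. These measures form a Markov kernel
(`Linf.exists_kernel`), and indicators determine both φ and the kernel.

In a commutative algebra the extreme states are exactly the characters, so pure σ-representability
says that the σ-spectrum separates elements. The Gelfand transform into `Linf (SigmaSpectrum A)` is
then injective; its range is σ-closed by σ-completeness of A and generates the σ-algebra by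
construction, so it is onto. Every purely σ-representable algebra is therefore isomorphic to a value
of the Koopman functor. The kernels κ_φ come from conjugating φ by Gelfand isomorphisms and using
fullness, and the equivalence is formal. In particular X need not be recovered point by point from
`Linf X`; it is only isomorphic in `Stoch` to the spectrum.

If the envelope of A is commutative, then A, which embeds in it, is some C(K). Bounded Baire
functions on K act on the universal Hilbert space by integration against spectral measures
(`baireCalculus`). Point evaluations are states, hence vector states, and this makes the calculus
injective with range exactly the σ-closure of A (`range_baireCalculus`). So the envelope is `Linf K`
for the Baire σ-algebra, and its σ-spectrum is K again. Separability of A makes K metrizable, where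
Baire and Borel sets coincide; conversely every standard Borel space is the Borel space of a compact
metrizable topology. -/

/-- A subspace is σ-closed if it contains the supremum of each increasing sequence of its
self-adjoint elements. -/
def Submodule.IsSigmaClosed {B : Type u} [CStarAlgebra B] [PartialOrder B] (V : Submodule ℂ B) :
    Prop :=
  ∀ (a : ℕ → B) (s : B), (∀ n, a n ∈ V) → IncreasesTo a s → s ∈ V

/-! ### Monotone class theorems for bounded measurable functions -/

namespace Linf

variable {X Y : Type u} [MeasurableSpace X] [MeasurableSpace Y]

/-- A bounded measurable real function as an element of `Linf X`. -/
def ofReal (f : X → ℝ) (hf : Measurable f) (C : ℝ) (hC : ∀ x, |f x| ≤ C) : Linf X :=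
  mk (fun x => (f x : ℂ)) (Complex.measurable_ofReal.comp hf) C fun x => by
    rw [Complex.norm_real]; exact hC x

@[simp] theorem ofReal_apply (f : X → ℝ) (hf : Measurable f) (C : ℝ) (hC : ∀ x, |f x| ≤ C)
    (x : X) : ofReal f hf C hC x = f x := rfl

theorem isSelfAdjoint_iff {f : Linf X} : IsSelfAdjoint f ↔ ∀ x, f x = ((f x).re : ℂ) := by
  constructor
  · intro h x
    exact (Complex.conj_eq_iff_re.mp (congrArg (fun f : Linf X => f x) h.star_eq)).symm
  · intro h
    exact ext fun x => Complex.conj_eq_iff_re.mpr (h x).symm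

theorem isSelfAdjoint_ofReal (f : X → ℝ) (hf : Measurable f) (C : ℝ) (hC : ∀ x, |f x| ≤ C) :
    IsSelfAdjoint (ofReal f hf C hC) :=
  isSelfAdjoint_iff.mpr fun x => by simp

theorem ofReal_le_ofReal {f g : X → ℝ} {hf : Measurable f} {hg : Measurable g} {C D : ℝ}
    {hC : ∀ x, |f x| ≤ C} {hD : ∀ x, |g x| ≤ D} (h : ∀ x, f x ≤ g x) :
    ofReal f hf C hC ≤ ofReal g hg D hD :=
  fun x => Complex.real_le_real.mpr (h x)

/-- A monotone sequence which converges pointwise increases to its limit. -/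
theorem increasesTo_of_tendsto {a : ℕ → Linf X} {s : Linf X} (hsa : ∀ n, IsSelfAdjoint (a n))
    (hm : Monotone a) (h : ∀ x, Tendsto (fun n => a n x) atTop (𝓝 (s x))) : IncreasesTo a s where
  isSelfAdjoint := hsa
  monotone := hm
  isLUB := by
    refine ⟨?_, fun g hg x => le_of_tendsto' (h x) fun n => hg ⟨n, rfl⟩ x⟩
    rintro _ ⟨n, rfl⟩ x
    exact Monotone.ge_of_tendsto (fun i j hij => hm hij x) (h x) n

/-- The indicator function of a measurable set. -/
def indicator (E : Set X) (hE : MeasurableSet E) : Linf X :=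
  ofReal (E.indicator 1) (measurable_one.indicator hE) 1 fun x => by
    by_cases h : x ∈ E <;> simp [h]

theorem indicator_of_mem {E : Set X} {hE : MeasurableSet E} {x : X} (h : x ∈ E) :
    indicator E hE x = 1 := by simp [indicator, h]

theorem indicator_of_notMem {E : Set X} {hE : MeasurableSet E} {x : X} (h : x ∉ E) :
    indicator E hE x = 0 := by simp [indicator, h]

/-- Induction over nonnegative measurable functions. The motive quantifies over the bounded function
`h`, so that finiteness and the bound `‖h‖` pass down from the final function to its summands and
approximants. -/
theorem mem_of_ennreal (V : Submodule ℂ (Linf X)) (hV : V.IsSigmaClosed)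
    (hind : ∀ E hE, indicator E hE ∈ V) {g : X → ℝ≥0∞} (hg : Measurable g) :
    ∀ h : Linf X, (∀ x, g x ≠ ∞ ∧ h x = ((g x).toReal : ℂ)) → h ∈ V := by
  refine Measurable.ennreal_induction (motive := fun g => ∀ h : Linf X,
    (∀ x, g x ≠ ∞ ∧ h x = ((g x).toReal : ℂ)) → h ∈ V) ?_ ?_ ?_ hg
  · intro c E hE h hh
    have : h = (c.toReal : ℂ) • indicator E hE := ext fun x => by
      rw [(hh x).2, smul_apply]
      by_cases hx : x ∈ E
      · simp [hx, indicator_of_mem]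
      · simp [hx, indicator_of_notMem]
    rw [this]
    exact V.smul_mem _ (hind E hE)
  · intro f g _ hf hg ihf ihg h hh
    have hbd : ∀ x, (f x).toReal + (g x).toReal ≤ ‖h‖ ∧ f x ≠ ∞ ∧ g x ≠ ∞ := fun x => by
      obtain ⟨h1, h2⟩ := hh x
      have h3 := ENNReal.add_ne_top.mp h1
      refine ⟨?_, h3⟩
      have h4 := h.norm_apply_le x
      rw [h2, Pi.add_apply, ENNReal.toReal_add h3.1 h3.2, Complex.norm_real] at h4
      exact (le_abs_self _).trans h4
    have hb1 : ∀ x, |(f x).toReal| ≤ ‖h‖ := fun x => by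
      rw [abs_of_nonneg ENNReal.toReal_nonneg]
      linarith [(hbd x).1, ENNReal.toReal_nonneg (a := g x)]
    have hb2 : ∀ x, |(g x).toReal| ≤ ‖h‖ := fun x => by
      rw [abs_of_nonneg ENNReal.toReal_nonneg]
      linarith [(hbd x).1, ENNReal.toReal_nonneg (a := f x)]
    have key : h = ofReal _ hf.ennreal_toReal _ hb1 + ofReal _ hg.ennreal_toReal _ hb2 :=
      ext fun x => by
        rw [(hh x).2, add_apply, ofReal_apply, ofReal_apply, Pi.add_apply,
          ENNReal.toReal_add (hbd x).2.1 (hbd x).2.2, Complex.ofReal_add]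
    rw [key]
    exact V.add_mem (ihf _ fun x => ⟨(hbd x).2.1, rfl⟩) (ihg _ fun x => ⟨(hbd x).2.2, rfl⟩)
  · intro f hf hmono ih h hh
    have hle : ∀ n x, f n x ≤ ⨆ n, f n x := fun n x => le_iSup (fun n => f n x) n
    have hfin : ∀ n x, f n x ≠ ∞ := fun n x => ne_top_of_le_ne_top (hh x).1 (hle n x)
    have hb : ∀ n x, |(f n x).toReal| ≤ ‖h‖ := fun n x => by
      rw [abs_of_nonneg ENNReal.toReal_nonneg]
      have h4 := h.norm_apply_le x
      rw [(hh x).2, Complex.norm_real] at h4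
      exact (ENNReal.toReal_mono (hh x).1 (hle n x)).trans ((le_abs_self _).trans h4)
    refine hV (fun n => ofReal _ (hf n).ennreal_toReal _ (hb n)) h
      (fun n => ih n _ fun x => ⟨hfin n x, rfl⟩) (increasesTo_of_tendsto
        (fun n => isSelfAdjoint_ofReal _ _ _ _)
        (fun i j hij => ofReal_le_ofReal fun x => ENNReal.toReal_mono (hfin j x) (hmono hij x))
        fun x => ?_)
    rw [(hh x).2]
    exact (Complex.continuous_ofReal.tendsto _).comp ((ENNReal.tendsto_toReal (hh x).1).comp
      (tendsto_atTop_iSup fun i j hij => hmono hij x))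

/-- A σ-closed subspace which contains all indicator functions is everything. -/
theorem eq_top_of_indicator_mem (V : Submodule ℂ (Linf X)) (hV : V.IsSigmaClosed)
    (hind : ∀ E hE, indicator E hE ∈ V) : V = ⊤ := by
  have hreal : ∀ (g : X → ℝ) (hg : Measurable g) (C : ℝ) (hC : ∀ x, |g x| ≤ C),
      ofReal g hg C hC ∈ V := by
    intro g hg C hC
    have hpos : ∀ (g : X → ℝ), Measurable g → (∀ x, |g x| ≤ C) →
        ∃ h ∈ V, ∀ x, h x = ((max (g x) 0 : ℝ) : ℂ) := fun g hg hC =>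
      ⟨ofReal (fun x => max (g x) 0) (hg.max measurable_const) C fun x => by
          rw [abs_of_nonneg (le_max_right _ _)]
          exact max_le ((le_abs_self _).trans (hC x)) ((abs_nonneg _).trans (hC x)),
        mem_of_ennreal V hV hind (g := fun x => ENNReal.ofReal (g x)) hg.ennreal_ofReal _
          fun x => ⟨ENNReal.ofReal_ne_top, by simp [ENNReal.toReal_ofReal']⟩, fun x => rfl⟩
    obtain ⟨p, hp, hp'⟩ := hpos g hg hC
    obtain ⟨q, hq, hq'⟩ := hpos (fun x => -g x) hg.neg fun x => by rw [abs_neg]; exact hC x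
    have : ofReal g hg C hC = p - q := ext fun x => by
      rw [sub_apply, hp', hq', ofReal_apply, ← Complex.ofReal_sub]
      congr 1
      rcases le_total 0 (g x) with h | h
      · rw [max_eq_left h, max_eq_right (by linarith)]; ring
      · rw [max_eq_right h, max_eq_left (by linarith)]; ring
    rw [this]
    exact V.sub_mem hp hq
  refine Submodule.eq_top_iff'.mpr fun f => ?_
  have : f = ofReal (fun x => (f x).re) (Complex.measurable_re.comp f.measurable) ‖f‖
        (fun x => (Complex.abs_re_le_norm _).trans (f.norm_apply_le x)) +
      Complex.I • ofReal (fun x => (f x).im) (Complex.measurable_im.comp f.measurable) ‖f‖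
        (fun x => (Complex.abs_im_le_norm _).trans (f.norm_apply_le x)) :=
    ext fun x => by
      rw [add_apply, smul_apply, ofReal_apply, ofReal_apply, mul_comm, Complex.re_add_im]
  rw [this]
  exact V.add_mem (hreal _ _ _ _) (V.smul_mem _ (hreal _ _ _ _))

/-- The partial sums of the indicators of disjoint sets increase to the indicator of the union. -/
theorem increasesTo_sum_indicator {f : ℕ → Set X} (hd : Pairwise (Function.onFun Disjoint f))
    (hfm : ∀ i, MeasurableSet (f i)) :
    IncreasesTo (fun n => ∑ i ∈ Finset.range n, indicator (f i) (hfm i))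
      (indicator (⋃ i, f i) (.iUnion hfm)) := by
  have hval : ∀ n x, (∑ i ∈ Finset.range n, indicator (f i) (hfm i) : Linf X) x =
      indicator (⋃ i ∈ Finset.range n, f i)
        (Finset.measurableSet_biUnion _ fun i _ => hfm i) x := by
    intro n x
    have : (∑ i ∈ Finset.range n, indicator (f i) (hfm i) : Linf X) x =
        ∑ i ∈ Finset.range n, indicator (f i) (hfm i) x := map_sum (eval x) _ _
    rw [this]
    by_cases hx : x ∈ ⋃ i ∈ Finset.range n, f i
    · rw [indicator_of_mem hx]
      simp only [Set.mem_iUnion] at hx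
      obtain ⟨i, hi, hxi⟩ := hx
      rw [Finset.sum_eq_single_of_mem i hi, indicator_of_mem hxi]
      intro j _ hji
      exact indicator_of_notMem fun hxj => Set.disjoint_left.mp (hd hji) hxj hxi
    · rw [indicator_of_notMem hx]
      refine Finset.sum_eq_zero fun i hi => indicator_of_notMem fun hxi => hx ?_
      exact Set.mem_biUnion hi hxi
  refine increasesTo_of_tendsto (fun n => ?_) ?_ fun x => ?_
  · exact isSelfAdjoint_sum _ fun i _ => isSelfAdjoint_ofReal _ _ _ _
  · refine monotone_nat_of_le_succ fun n => ?_
    rw [Finset.sum_range_succ]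
    exact le_add_of_nonneg_right fun x => Complex.zero_le_real.mpr
      (Set.indicator_nonneg (fun _ _ => zero_le_one) x)
  · refine tendsto_const_nhds.congr' ?_
    by_cases hx : x ∈ ⋃ i, f i
    · obtain ⟨i, hi⟩ := Set.mem_iUnion.mp hx
      filter_upwards [eventually_gt_atTop i] with n hn
      rw [hval, indicator_of_mem hx, indicator_of_mem]
      exact Set.mem_biUnion (Finset.mem_coe.mpr (Finset.mem_range.mpr hn)) hi
    · filter_upwards with n
      rw [hval, indicator_of_notMem hx, indicator_of_notMem]
      exact fun h => hx (Set.iUnion₂_subset_iUnion _ _ h)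

/-- A σ-closed subspace which contains the constants and the indicators of a generating π-system is
everything. -/
theorem eq_top_of_isPiSystem (V : Submodule ℂ (Linf X)) (hV : V.IsSigmaClosed) (h1 : 1 ∈ V)
    {S : Set (Set X)} (hS : IsPiSystem S) (hgen : ‹MeasurableSpace X› = MeasurableSpace.generateFrom S)
    (hind : ∀ E ∈ S, ∀ hE, indicator E hE ∈ V) : V = ⊤ := by
  refine eq_top_of_indicator_mem V hV fun E hE => ?_
  induction E, hE using MeasurableSpace.induction_on_inter hgen hS with
  | empty =>
    convert V.zero_mem
    exact ext fun x => indicator_of_notMem (Set.notMem_empty x)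
  | basic t ht => exact hind t ht _
  | compl t htm ih =>
    convert V.sub_mem h1 ih
    refine ext fun x => ?_
    by_cases hx : x ∈ t
    · rw [indicator_of_notMem (by simpa using hx), sub_apply, indicator_of_mem hx]; simp
    · rw [indicator_of_mem (by simpa using hx), sub_apply, indicator_of_notMem hx]; simp
  | iUnion f hd hfm ih =>
    exact hV _ _ (fun n => V.sum_mem fun i _ => ih i) (increasesTo_sum_indicator hd hfm)

/-- Functional monotone class theorem: a σ-closed subspace which contains a family of functions that
generates the σ-algebra and is stable under products and under composition with continuous
functions is everything. -/
theorem eq_top_of_generating (V : Submodule ℂ (Linf X)) (hV : V.IsSigmaClosed) (h1 : 1 ∈ V)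
    (T : Set (Linf X)) (hTV : T ⊆ V) (hmul : ∀ f ∈ T, ∀ g ∈ T, f * g ∈ T)
    (hcomp : ∀ f ∈ T, ∀ g : C(ℂ, ℂ), ∃ h ∈ T, ∀ x, h x = g (f x))
    (hgen : ‹MeasurableSpace X› ≤ ⨆ f ∈ T, (borel ℂ).comap f) : V = ⊤ := by
  refine eq_top_of_isPiSystem V hV h1 (S := {E | ∃ f ∈ T, E = {x | f x ≠ 0}}) ?_ ?_ ?_
  -- Nonvanishing sets are stable under intersection because `ℂ` has no zero divisors.
  · rintro _ ⟨f, hf, rfl⟩ _ ⟨g, hg, rfl⟩ _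
    exact ⟨f * g, hmul f hf g hg, by ext x; simp⟩
  · refine le_antisymm (hgen.trans (iSup₂_le fun f hf => ?_)) ?_
    · rw [borel, MeasurableSpace.comap_generateFrom]
      refine MeasurableSpace.generateFrom_le ?_
      rintro _ ⟨U, hU, rfl⟩
      by_cases hU' : Uᶜ.Nonempty
      -- The preimage of an open `U` under `f` is the nonvanishing set of the distance from `f` to
      -- the complement of `U`. This fails for an empty complement, where `infDist` is 0 by
      -- convention.
      · obtain ⟨h, hT, hh⟩ := hcomp f hf
          ⟨fun z => (Metric.infDist z Uᶜ : ℂ),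
            Complex.continuous_ofReal.comp (Metric.continuous_infDist_pt _)⟩
        refine MeasurableSpace.measurableSet_generateFrom ⟨h, hT, ?_⟩
        ext x
        have := (isClosed_compl_iff.mpr (show IsOpen U from hU)).mem_iff_infDist_zero (x := f x) hU'
        simp only [Set.mem_preimage, Set.mem_ofPred_eq, hh, ContinuousMap.coe_mk,
          Complex.ofReal_ne_zero, ne_eq, ← this]
        simp
      · rw [Set.not_nonempty_iff_eq_empty, Set.compl_empty_iff] at hU'
        rw [hU', Set.preimage_univ]
        exact MeasurableSet.univ
    · refine MeasurableSpace.generateFrom_le ?_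
      rintro _ ⟨f, _, rfl⟩
      exact f.measurable (measurableSet_singleton 0).compl
  · rintro _ ⟨f, hf, rfl⟩ hE
    -- The functions min(1, n|f|) lie in `T` and increase to the indicator of the nonvanishing set
    -- of `f`.
    choose h hT hh using fun n : ℕ => hcomp f hf
      ⟨fun z => ((min 1 (n * ‖z‖) : ℝ) : ℂ), by fun_prop⟩
    simp only [ContinuousMap.coe_mk] at hh
    refine hV h _ (fun n => hTV (hT n)) (increasesTo_of_tendsto (fun n => ?_) ?_ fun x => ?_)
    · exact isSelfAdjoint_iff.mpr fun x => by rw [hh, Complex.ofReal_re]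
    · intro i j hij x
      rw [hh, hh]
      refine Complex.real_le_real.mpr (min_le_min_left _ ?_)
      gcongr
    · by_cases hx : f x = 0
      · rw [indicator_of_notMem (by simpa using hx)]
        simp [hh, hx]
      · rw [indicator_of_mem (by simpa using hx)]
        obtain ⟨N, hN⟩ := exists_nat_gt (1 / ‖f x‖)
        refine tendsto_const_nhds.congr' ?_
        filter_upwards [eventually_ge_atTop N] with n hn
        have h0 : 0 < ‖f x‖ := norm_pos_iff.mpr hx
        have h2 : (N : ℝ) ≤ n := by exact_mod_cast hn
        have h3 : 1 ≤ n * ‖f x‖ := by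
          rw [div_lt_iff₀ h0] at hN
          nlinarith
        rw [hh, min_eq_left h3, Complex.ofReal_one]

end Linf

/-- Suprema are unique. This is what lets the monotone class theorems prove equality of σ-normal
maps. -/
theorem LinearMap.isSigmaClosed_eqLocus {A : Type u} {B : Type v} [CStarAlgebra A] [PartialOrder A]
    [CStarAlgebra B] [PartialOrder B] {φ ψ : A →ₗ[ℂ] B} (hφ : IsSigmaNormal φ)
    (hψ : IsSigmaNormal ψ) : (LinearMap.eqLocus φ ψ).IsSigmaClosed := by
  intro a s ha h
  have h1 := hφ a s h
  have h2 := hψ a s h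
  have h3 : (fun n => φ (a n)) = fun n => ψ (a n) := funext ha
  rw [h3] at h1
  exact h1.unique h2

/-! ### Full faithfulness of the Koopman functor -/

namespace Linf

variable {X Y : Type u} [MeasurableSpace X] [MeasurableSpace Y]

theorem sigmaCPUMap_ext {B : Type u} [CStarAlgebra B] [PartialOrder B] [StarOrderedRing B]
    {φ ψ : SigmaCPUMap (Linf Y) B} (h : ∀ E hE, φ (indicator E hE) = ψ (indicator E hE)) :
    φ = ψ := by
  have := eq_top_of_indicator_mem
    (LinearMap.eqLocus φ.toLinearMap ψ.toLinearMap)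
    (LinearMap.isSigmaClosed_eqLocus φ.isSigmaNormal' ψ.isSigmaNormal') h
  exact SigmaCPUMap.ext fun a => (this ▸ Submodule.mem_top : a ∈ LinearMap.eqLocus _ _)

theorem indicator_nonneg (E : Set X) (hE : MeasurableSet E) : 0 ≤ indicator E hE := fun x =>
  Complex.zero_le_real.mpr (Set.indicator_nonneg (fun _ _ => zero_le_one) x)

theorem koopmanFun_indicator (κ : Kernel X Y) [IsMarkovKernel κ] (E : Set Y)
    (hE : MeasurableSet E) (x : X) :
    koopmanFun κ (indicator E hE) x = ((κ x).real E : ℂ) := by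
  change ∫ y, ((E.indicator 1 y : ℝ) : ℂ) ∂(κ x) = _
  rw [integral_complex_ofReal, integral_indicator_one hE]

/-- Every σ-cpu map between algebras of bounded measurable functions is the Koopman operator of a
Markov kernel. -/
theorem exists_kernel (φ : SigmaCPUMap (Linf Y) (Linf X)) :
    ∃ (κ : Kernel X Y) (_ : IsMarkovKernel κ), koopmanMap κ = φ := by
  have hnn : ∀ E hE x, 0 ≤ φ (indicator E hE) x := fun E hE x => by
    have h := OrderHomClass.mono φ.toCompletelyPositiveMap (indicator_nonneg E hE) x
    rw [map_zero] at h
    exact h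
  have hre : ∀ E hE x, φ (indicator E hE) x = ((φ (indicator E hE) x).re : ℂ) := fun E hE x =>
    Complex.eq_re_of_ofReal_le (r := 0) (by simpa using hnn E hE x)
  -- σ-normality becomes countable additivity: the partial sums of indicators of disjoint sets
  -- increase to the indicator of the union, and suprema in `Linf X` are pointwise limits.
  have hsum : ∀ (f : ℕ → Set Y) (_ : Pairwise (Function.onFun Disjoint f))
      (hfm : ∀ i, MeasurableSet (f i)) (x : X),
      HasSum (fun i => (φ (indicator (f i) (hfm i)) x).re)
        (φ (indicator (⋃ i, f i) (.iUnion hfm)) x).re := by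
    intro f hd hfm x
    rw [hasSum_iff_tendsto_nat_of_nonneg fun i => (Complex.le_def.mp (hnn _ _ x)).1]
    have h := tendsto_of_increasesTo (φ.increasesTo (increasesTo_sum_indicator hd hfm)) x
    refine ((Complex.continuous_re.tendsto _).comp h).congr fun n => ?_
    have h1 : φ (∑ i ∈ Finset.range n, indicator (f i) (hfm i)) =
        ∑ i ∈ Finset.range n, φ (indicator (f i) (hfm i)) := map_sum φ.toCompletelyPositiveMap _ _
    simp only [Function.comp_apply, h1]
    exact (congrArg Complex.re (map_sum (eval x) _ _)).trans (map_sum Complex.reCLM _ _)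
  let μ : X → Measure Y := fun x => Measure.ofMeasurable
    (fun E hE => ENNReal.ofReal (φ (indicator E hE) x).re)
    (by
      have : indicator (∅ : Set Y) .empty = 0 :=
        ext fun y => indicator_of_notMem (Set.notMem_empty y)
      have h0 : φ 0 = 0 := map_zero φ.toCompletelyPositiveMap
      simp [this, h0])
    (fun f hfm hd => by
      rw [← (hsum f hd hfm x).tsum_eq, ENNReal.ofReal_tsum_of_nonneg
        (fun i => (Complex.le_def.mp (hnn _ _ x)).1) (hsum f hd hfm x).summable])
  have hμ : ∀ x E hE, μ x E = ENNReal.ofReal (φ (indicator E hE) x).re := fun x E hE =>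
    Measure.ofMeasurable_apply E hE
  let κ : Kernel X Y :=
    { toFun := μ
      measurable' := Measure.measurable_of_measurable_coe _ fun E hE => by
        simp_rw [hμ _ E hE]
        exact (Complex.measurable_re.comp (φ (indicator E hE)).measurable).ennreal_ofReal }
  have hκ : IsMarkovKernel κ := ⟨fun x => ⟨by
    have h1 : indicator (Set.univ : Set Y) .univ = 1 :=
      ext fun y => indicator_of_mem (Set.mem_univ y)
    have h2 : φ 1 = 1 := φ.map_one'
    change μ x _ = 1
    rw [hμ x _ .univ, h1, h2]
    simp⟩⟩
  refine ⟨κ, hκ, sigmaCPUMap_ext fun E hE => ext fun x => ?_⟩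
  refine (koopmanFun_indicator κ E hE x).trans ?_
  rw [hre]
  change ((μ x E).toReal : ℂ) = _
  rw [hμ x E hE, ENNReal.toReal_ofReal (Complex.le_def.mp (hnn _ _ x)).1]

theorem koopmanMap_injective {κ η : Kernel X Y} [IsMarkovKernel κ] [IsMarkovKernel η]
    (h : koopmanMap κ = koopmanMap η) : κ = η := by
  refine Kernel.ext fun x => Measure.ext fun E hE => ?_
  have h1 := congrArg (fun φ : SigmaCPUMap (Linf Y) (Linf X) => φ (indicator E hE) x) h
  have h2 : koopmanFun κ (indicator E hE) x = koopmanFun η (indicator E hE) x := h1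
  rw [koopmanFun_indicator, koopmanFun_indicator, Complex.ofReal_inj] at h2
  exact (measureReal_eq_measureReal_iff).mp h2

end Linf

instance koopman_full : koopman.{u}.Full where
  map_surjective {X Y} φ := by
    obtain ⟨κ, hκ, h⟩ := Linf.exists_kernel φ
    exact ⟨Quiver.Hom.op ⟨⟨κ, inferInstance⟩, hκ⟩, h⟩

instance koopman_faithful : koopman.{u}.Faithful where
  map_injective {X Y} κ η h := by
    refine Quiver.Hom.unop_inj (WideSubcategory.hom_ext _ (SFinKer.hom_ext ?_))
    exact Linf.koopmanMap_injective h

/-! ### Pure states of commutative algebras are characters -/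

section Characters

variable {A : Type u}

/-- Characters are extreme states. -/
theorem mem_extremePoints_states [CStarAlgebra A] [PartialOrder A] [StarOrderedRing A]
    (χ : A →⋆ₐ[ℂ] ℂ) : (χ : A →ₐ[ℂ] ℂ).toLinearMap ∈ (states A).extremePoints ℝ := by
  refine mem_extremePoints_iff_left.mpr ⟨⟨fun a ha => map_nonneg χ ha, map_one χ⟩, ?_⟩
  rintro φ hφ ψ hψ ⟨s, t, hs, ht, -, hst⟩
  -- If χ kills `a` it kills a⋆a, so the nonnegative numbers φ(a⋆a) and ψ(a⋆a) have a vanishing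
  -- combination with positive weights. Then φ(a⋆a) = 0, and Cauchy–Schwarz against 1 gives φ(a) =
  -- 0. Unitality finishes, since the kernel of χ together with 1 spans the algebra.
  have hker : ∀ a, χ a = 0 → φ a = 0 := by
    intro a ha
    have h1 : (s : ℂ) * φ (star a * a) + t * ψ (star a * a) = 0 := by
      have := LinearMap.congr_fun hst (star a * a)
      simpa [ha] using this
    have h2 := hφ.1 _ (star_mul_self_nonneg a)
    have h3 := hψ.1 _ (star_mul_self_nonneg a)
    have hs' : (0 : ℂ) < s := Complex.zero_lt_real.mpr hs
    have ht' : (0 : ℂ) < t := Complex.zero_lt_real.mpr ht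
    have h4 : φ (star a * a) = 0 := by
      have := (add_eq_zero_iff_of_nonneg (mul_nonneg hs'.le h2) (mul_nonneg ht'.le h3)).mp h1
      exact (mul_eq_zero.mp this.1).resolve_left hs'.ne'
    let f : A →ₚ[ℂ] ℂ := PositiveLinearMap.mk₀ φ hφ.1
    have h5 := norm_inner_le_norm (𝕜 := ℂ) (f.toPreGNS 1) (f.toPreGNS a)
    have h6 : ‖f.toPreGNS a‖ = 0 := by
      rw [PositiveLinearMap.preGNS_norm_def]
      change √(φ (star a * a)).re = 0
      simp [h4]
    rw [h6, mul_zero, PositiveLinearMap.preGNS_inner_def] at h5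
    have h7 : ‖φ (star 1 * a)‖ ≤ 0 := h5
    simpa using h7
  refine LinearMap.ext fun a => ?_
  have h := hker (a - algebraMap ℂ A (χ a)) (by
    rw [map_sub, AlgHomClass.commutes]; exact sub_self _)
  rw [map_sub, sub_eq_zero, Algebra.algebraMap_eq_smul_one, map_smul, hφ.2] at h
  simpa using h

/-- Extreme states of commutative C⋆-algebras are multiplicative. -/
theorem map_mul_of_mem_extremePoints_states [CommCStarAlgebra A] [PartialOrder A]
    [StarOrderedRing A] {φ : A →ₗ[ℂ] ℂ} (hφ : φ ∈ (states A).extremePoints ℝ) (a b : A) :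
    φ (a * b) = φ a * φ b := by
  obtain ⟨⟨hpos, hone⟩, hext⟩ := mem_extremePoints_iff_left.mp hφ
  have hmulnn : ∀ a b : A, 0 ≤ a → 0 ≤ b → 0 ≤ a * b := by
    intro a b ha hb
    obtain ⟨c, rfl⟩ := CStarAlgebra.nonneg_iff_eq_star_mul_self.mp ha
    rw [mul_assoc, mul_comm c b, ← mul_assoc]
    exact star_left_conjugate_nonneg hb c
  -- For 0 ≤ a ≤ 1 with 0 < t = φ(a) < 1, φ is the convex combination, with weights t and 1 − t, of
  -- the states φ(a·)/t and φ((1 − a)·)/(1 − t). Extremality forces φ(a·) = t φ.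
  have key : ∀ (a : A) (t : ℝ), 0 < t → t < 1 → φ a = t → 0 ≤ a → a ≤ 1 →
      ∀ b, φ (a * b) = φ a * φ b := by
    intro a t ht0 ht1 hta ha0 ha1 b
    have ht0' : (0 : ℂ) < t := Complex.zero_lt_real.mpr ht0
    have ht1' : (0 : ℂ) < 1 - t := by
      rw [← Complex.ofReal_one, ← Complex.ofReal_sub]
      exact Complex.zero_lt_real.mpr (by linarith)
    have h := hext ((t : ℂ)⁻¹ • (φ ∘ₗ LinearMap.mulLeft ℂ a)) ⟨fun c hc => ?_, ?_⟩
      ((1 - t : ℂ)⁻¹ • (φ ∘ₗ LinearMap.mulLeft ℂ (1 - a))) ⟨fun c hc => ?_, ?_⟩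
      ⟨t, 1 - t, ht0, by linarith, by ring, ?_⟩
    · have h1 := LinearMap.congr_fun h b
      simp only [LinearMap.smul_apply, LinearMap.comp_apply, LinearMap.mulLeft_apply,
        smul_eq_mul] at h1
      rw [← h1, hta, mul_inv_cancel_left₀ ht0'.ne']
    · exact mul_nonneg (inv_nonneg.mpr ht0'.le) (hpos _ (hmulnn _ _ ha0 hc))
    · simp [hta, ht0'.ne']
    · exact mul_nonneg (inv_nonneg.mpr ht1'.le) (hpos _ (hmulnn _ _ (sub_nonneg.mpr ha1) hc))
    · simp [hta, hone, ht1'.ne']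
    · refine LinearMap.ext fun c => ?_
      have e1 := ht0'.ne'
      have e2 := ht1'.ne'
      simp only [LinearMap.add_apply, LinearMap.smul_apply, LinearMap.comp_apply,
        LinearMap.mulLeft_apply, Complex.real_smul, smul_eq_mul, Complex.ofReal_sub,
        Complex.ofReal_one, mul_inv_cancel_left₀ e1, mul_inv_cancel_left₀ e2, sub_mul, one_mul,
        map_sub]
      ring
  let K : Submodule ℂ A :=
    { carrier := {a | ∀ b, φ (a * b) = φ a * φ b}
      add_mem' := fun {x y} hx hy b => by rw [add_mul, map_add, map_add, hx, hy, add_mul]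
      zero_mem' := fun b => by simp
      smul_mem' := fun c x hx b => by
        rw [smul_mul_assoc, map_smul, map_smul, hx, smul_eq_mul, smul_eq_mul, mul_assoc] }
  have hK1 : (1 : A) ∈ K := fun b => by rw [one_mul, hone, one_mul]
  have hKnn : ∀ a : A, 0 ≤ a → a ∈ K := by
    intro a ha
    -- This scaling gives 0 ≤ r⁻¹a ≤ 1/3, so `a'` lies between 1/3 and 2/3 and φ(a') is strictly
    -- inside (0, 1), as `key` requires. The element `a` is recovered as a combination of `a'` and
    -- 1.
    set r : ℝ := 3 * (‖a‖ + 1) with hr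
    have hr0 : 0 < r := by positivity
    set a' : A := (3⁻¹ : ℝ) • 1 + r⁻¹ • a with ha'
    have hle : a ≤ (‖a‖ + 1) • (1 : A) := by
      refine (IsSelfAdjoint.of_nonneg ha).le_algebraMap_norm_self.trans ?_
      rw [Algebra.algebraMap_eq_smul_one, add_smul]
      exact le_add_of_nonneg_right (smul_nonneg zero_le_one zero_le_one)
    have hle' : r⁻¹ • a ≤ (3⁻¹ : ℝ) • (1 : A) := by
      refine (smul_le_smul_of_nonneg_left hle (inv_nonneg.mpr hr0.le)).trans_eq ?_
      rw [smul_smul]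
      congr 1
      rw [hr]; field_simp
    have ha1 : (0 : A) ≤ r⁻¹ • a := smul_nonneg (inv_nonneg.mpr hr0.le) ha
    have hφr : ∀ (s : ℝ) (c : A), φ (s • c) = s * φ c := fun s c => by
      rw [← Complex.coe_smul, map_smul, smul_eq_mul]
    have h0 := Complex.le_def.mp (hpos _ ha1)
    have h1 := Complex.le_def.mp (hpos _ (sub_nonneg.mpr hle'))
    rw [map_sub, hφr 3⁻¹, hone] at h1
    simp only [mul_one, Complex.sub_re, Complex.ofReal_re, Complex.zero_re] at h1
    simp only [Complex.zero_re, Complex.zero_im] at h0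
    have h2 : a' ∈ K := by
      refine key a' (3⁻¹ + (φ (r⁻¹ • a)).re) (by linarith) (by linarith) ?_ ?_ ?_
      · rw [ha', map_add, hφr 3⁻¹, hone, mul_one, Complex.ofReal_add]
        congr 1
        exact Complex.ext rfl h0.2.symm
      · exact add_nonneg (smul_nonneg (by norm_num) zero_le_one) ha1
      · calc a' ≤ (3⁻¹ : ℝ) • 1 + (3⁻¹ : ℝ) • (1 : A) := by rw [ha']; gcongr
          _ ≤ (3⁻¹ : ℝ) • 1 + (3⁻¹ : ℝ) • (1 : A) + (3⁻¹ : ℝ) • (1 : A) :=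
            le_add_of_nonneg_right (smul_nonneg (by norm_num) zero_le_one)
          _ = 1 := by rw [← add_smul, ← add_smul]; norm_num
    have h3 : a = (r : ℂ) • (a' - (3⁻¹ : ℂ) • (1 : A)) := by
      have : (3⁻¹ : ℂ) • (1 : A) = (3⁻¹ : ℝ) • (1 : A) := by
        rw [← Complex.coe_smul]; norm_num
      rw [this, ha', add_sub_cancel_left, Complex.coe_smul, smul_smul, mul_inv_cancel₀ hr0.ne',
        one_smul]
    rw [h3]
    exact K.smul_mem _ (K.sub_mem h2 (K.smul_mem _ hK1))
  have hKtop : K = ⊤ := by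
    rw [eq_top_iff, ← CStarAlgebra.span_nonneg (A := A)]
    exact Submodule.span_le.mpr fun a ha => hKnn a ha
  exact (hKtop ▸ Submodule.mem_top : a ∈ K) b

theorem exists_starAlgHom_of_mem_pureSigmaStates [CommCStarAlgebra A] [PartialOrder A]
    [StarOrderedRing A] {φ : A →ₗ[ℂ] ℂ} (hφ : φ ∈ pureSigmaStates A) :
    ∃ χ : SigmaSpectrum A, ∀ a, χ.1 a = φ a := by
  have hst := hφ.1.1
  let f : A →ₐ[ℂ] ℂ := AlgHom.ofLinearMap φ hst.2 (map_mul_of_mem_extremePoints_states hφ.1)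
  exact ⟨⟨{ f with
    map_star' := fun a => map_star (PositiveLinearMap.mk₀ φ hst.1) a }, hφ.2⟩, fun _ => rfl⟩

theorem mem_pureSigmaStates [CStarAlgebra A] [PartialOrder A] [StarOrderedRing A]
    (χ : SigmaSpectrum A) : (χ.1 : A →ₐ[ℂ] ℂ).toLinearMap ∈ pureSigmaStates A :=
  ⟨mem_extremePoints_states χ.1, χ.2⟩

/-- Pure σ-states and points of the σ-spectrum are the same functionals, so the condition can be
tested on characters. -/
theorem isPurelySigmaRepresentable_iff [CommCStarAlgebra A] [PartialOrder A]
    [StarOrderedRing A] : IsPurelySigmaRepresentable A ↔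
      ∀ x : A, 0 ≤ x → (∀ χ : SigmaSpectrum A, χ.1 x = 0) → x = 0 := by
  refine forall₂_congr fun x _ => ⟨fun h hx => h fun φ hφ => ?_, fun h hx => h fun χ => ?_⟩
  · obtain ⟨χ, hχ⟩ := exists_starAlgHom_of_mem_pureSigmaStates hφ
    rw [← hχ, hx]
  · exact hx _ (mem_pureSigmaStates χ)

end Characters

theorem Linf.isSigmaNormal_eval {X : Type u} [MeasurableSpace X] (x : X) :
    IsSigmaNormal (Linf.eval x) := by
  intro a s h
  have hm : Monotone fun n => Linf.eval x (a n) := fun i j hij => h.monotone hij x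
  exact isLUB_of_tendsto_atTop hm (Linf.tendsto_of_increasesTo h x)

/-- Evaluation at a point as an element of the Gelfand σ-spectrum. -/
def Linf.evalSpec {X : Type u} [MeasurableSpace X] (x : X) : SigmaSpectrum (Linf X) :=
  ⟨Linf.eval x, Linf.isSigmaNormal_eval x⟩

theorem Linf.isPurelySigmaRepresentable (X : Type u) [MeasurableSpace X] :
    IsPurelySigmaRepresentable (Linf X) :=
  isPurelySigmaRepresentable_iff.mpr fun _ _ h => Linf.ext fun x => h (Linf.evalSpec x)

/-! ### Star homomorphisms, order and σ-normality -/

section StarHoms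

variable {A : Type u} {B : Type v} [CStarAlgebra A] [PartialOrder A] [StarOrderedRing A]
  [CStarAlgebra B] [PartialOrder B] [StarOrderedRing B]

/-- Injective star homomorphisms reflect the order. -/
theorem StarAlgHom.le_of_map_le (φ : A →⋆ₐ[ℂ] B) (hφ : Function.Injective φ) {a b : A}
    (ha : IsSelfAdjoint a) (hb : IsSelfAdjoint b) (h : φ a ≤ φ b) : a ≤ b := by
  rw [← sub_nonneg]
  refine Linf.nonneg_of_forall_map (ι := Unit)
    (fun _ => NonUnitalStarAlgHomClass.toNonUnitalStarAlgHom φ) (fun c hc => ?_) (hb.sub ha)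
    fun _ => ?_
  · exact hφ ((hc ()).trans (map_zero φ).symm)
  · change 0 ≤ φ (b - a)
    rw [map_sub, sub_nonneg]
    exact h

theorem StarAlgEquiv.isSigmaNormal (e : A ≃⋆ₐ[ℂ] B) : IsSigmaNormal e := by
  intro a s h
  have hmono : Monotone e := OrderHomClass.mono e
  have hmono' : Monotone e.symm := OrderHomClass.mono e.symm
  refine ⟨?_, fun c hc => ?_⟩
  · rintro _ ⟨n, rfl⟩
    exact hmono (h.isLUB.1 ⟨n, rfl⟩)
  · have : s ≤ e.symm c := h.isLUB.2 (by
      rintro _ ⟨n, rfl⟩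
      simpa using hmono' (hc ⟨n, rfl⟩))
    simpa using hmono this

/-- A star isomorphism as a σ-cpu map. -/
def SigmaCPUMap.ofStarAlgEquiv (e : A ≃⋆ₐ[ℂ] B) : SigmaCPUMap A B where
  toCompletelyPositiveMap := CompletelyPositiveMapClass.toCompletelyPositiveLinearMap e
  map_one' := map_one e
  isSigmaNormal' := e.isSigmaNormal

theorem IncreasesTo.map_starAlgEquiv {e : A ≃⋆ₐ[ℂ] B} {a : ℕ → A} {s : A} (h : IncreasesTo a s) :
    IncreasesTo (fun n => e (a n)) (e s) :=
  (SigmaCPUMap.ofStarAlgEquiv e).increasesTo h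

/-- The action of star isomorphisms on the Gelfand σ-spectrum. -/
def SigmaSpectrum.comap (e : A ≃⋆ₐ[ℂ] B) (χ : SigmaSpectrum B) : SigmaSpectrum A :=
  ⟨χ.1.comp (e : A →⋆ₐ[ℂ] B), fun _ _ h => χ.2 _ _ (h.map_starAlgEquiv (e := e))⟩

@[simp] theorem SigmaSpectrum.comap_apply (e : A ≃⋆ₐ[ℂ] B) (χ : SigmaSpectrum B) (a : A) :
    (SigmaSpectrum.comap e χ).1 a = χ.1 (e a) := rfl

end StarHoms

/-! ### The Gelfand transform on the σ-spectrum -/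

section SigmaGelfand

@[ext] theorem SigmaSpectrum.ext {A : Type u} [CStarAlgebra A] [PartialOrder A]
    {χ ψ : SigmaSpectrum A} (h : ∀ a, χ.1 a = ψ.1 a) : χ = ψ :=
  Subtype.ext (DFunLike.ext _ _ h)

theorem SigmaSpectrum.measurable_apply {A : Type u} [CStarAlgebra A] [PartialOrder A] (a : A) :
    Measurable fun χ : SigmaSpectrum A => χ.1 a :=
  Measurable.of_comap_le (le_iSup (fun a : A => (borel ℂ).comap fun χ : SigmaSpectrum A => χ.1 a) a)

variable (A : Type u) [CommCStarAlgebra A] [PartialOrder A]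

/-- The Gelfand transform of a commutative C⋆-algebra on its σ-spectrum. -/
def sigmaGelfand : A →⋆ₐ[ℂ] Linf (SigmaSpectrum A) where
  toFun a := Linf.mk (fun χ => χ.1 a) (SigmaSpectrum.measurable_apply a) ‖a‖ fun χ =>
    NonUnitalStarAlgHom.norm_apply_le χ.1 a
  map_one' := Linf.ext fun χ => map_one χ.1
  map_mul' a b := Linf.ext fun χ => map_mul χ.1 a b
  map_zero' := Linf.ext fun χ => map_zero χ.1
  map_add' a b := Linf.ext fun χ => map_add χ.1 a b
  commutes' r := Linf.ext fun χ => AlgHomClass.commutes χ.1 r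
  map_star' a := Linf.ext fun χ => map_star χ.1 a

@[simp] theorem sigmaGelfand_apply (a : A) (χ : SigmaSpectrum A) :
    sigmaGelfand A a χ = χ.1 a := rfl

/-- The order on the target is pointwise, and each point of the σ-spectrum is σ-normal by
definition. -/
theorem isSigmaNormal_sigmaGelfand : IsSigmaNormal (sigmaGelfand A) := by
  refine fun a s h => ⟨?_, fun g hg χ => (χ.2 a s h).2 ?_⟩
  · rintro _ ⟨n, rfl⟩ χ
    exact (χ.2 a s h).1 ⟨n, rfl⟩
  · rintro _ ⟨n, rfl⟩
    exact hg ⟨n, rfl⟩ χ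

variable {A} [StarOrderedRing A]

theorem sigmaGelfand_injective (hA : IsPurelySigmaRepresentable A) :
    Function.Injective (sigmaGelfand A) := by
  refine (injective_iff_map_eq_zero _).mpr fun a ha => ?_
  refine CStarRing.star_mul_self_eq_zero_iff a |>.mp
    (isPurelySigmaRepresentable_iff.mp hA _ (star_mul_self_nonneg a) fun χ => ?_)
  have : χ.1 a = 0 := congrArg (fun f : Linf _ => f χ) ha
  rw [map_mul, this, mul_zero]

/-- The range is a σ-closed subspace containing generators of the σ-algebra, so the functional
monotone class theorem applies. -/
theorem sigmaGelfand_surjective (hA : IsPurelySigmaRepresentable A) (hσ : IsSigmaComplete A) :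
    Function.Surjective (sigmaGelfand A) := by
  have hinj := sigmaGelfand_injective hA
  let V : Submodule ℂ (Linf (SigmaSpectrum A)) :=
    LinearMap.range (sigmaGelfand A : A →ₐ[ℂ] Linf (SigmaSpectrum A)).toLinearMap
  have hV : V.IsSigmaClosed := by
    intro f s hf h
    choose a ha using hf
    replace ha : ∀ n, sigmaGelfand A (a n) = f n := ha
    -- An injective star homomorphism reflects self-adjointness and order and preserves norms. The
    -- lifted sequence therefore has a supremum in `A`, which σ-normality of the transform carries
    -- to `s`.
    have hsa : ∀ n, IsSelfAdjoint (a n) := fun n => hinj (by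
      rw [map_star, ha]; exact (h.isSelfAdjoint n).star_eq)
    obtain ⟨t, ht⟩ := hσ a hsa
      (fun i j hij => StarAlgHom.le_of_map_le _ hinj (hsa i) (hsa j) (by
        rw [ha, ha]; exact h.monotone hij))
      ⟨‖f 0‖ + ‖s‖, fun n => by
        rw [← NonUnitalStarAlgHom.norm_map _ hinj, ha]
        exact Linf.norm_le_of_increasesTo h n⟩
    have h1 := isSigmaNormal_sigmaGelfand A a t ht
    simp_rw [ha] at h1
    exact ⟨t, h1.unique h.isLUB⟩
  have htop : V = ⊤ := by
    refine Linf.eq_top_of_generating V hV ⟨1, map_one (sigmaGelfand A)⟩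
      (Set.range (sigmaGelfand A)) ?_ ?_ ?_ ?_
    · rintro _ ⟨a, rfl⟩
      exact ⟨a, rfl⟩
    · rintro _ ⟨a, rfl⟩ _ ⟨b, rfl⟩
      exact ⟨a * b, map_mul _ a b⟩
    -- Characters commute with the continuous functional calculus, so the range is stable under
    -- composition with continuous functions.
    · rintro _ ⟨a, rfl⟩ g
      refine ⟨_, ⟨cfc (g : ℂ → ℂ) a, rfl⟩, fun χ => ?_⟩
      rw [sigmaGelfand_apply, sigmaGelfand_apply]
      rw [StarAlgHomClass.map_cfc (S := ℂ) χ.1 (g : ℂ → ℂ) a (hφ := map_continuous χ.1)]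
      exact cfc_algebraMap (A := ℂ) (χ.1 a) (g : ℂ → ℂ)
    · refine iSup_le fun a => ?_
      exact le_iSup₂_of_le (sigmaGelfand A a) ⟨a, rfl⟩ le_rfl
  intro f
  exact (htop ▸ Submodule.mem_top : f ∈ V)

/-- Commutative purely σ-representable σC⋆-algebras are algebras of bounded measurable functions. -/
def sigmaGelfandEquiv (hA : IsPurelySigmaRepresentable A) (hσ : IsSigmaComplete A) :
    A ≃⋆ₐ[ℂ] Linf (SigmaSpectrum A) :=
  StarAlgEquiv.ofBijective (sigmaGelfand A)
    ⟨sigmaGelfand_injective hA, sigmaGelfand_surjective hA hσ⟩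

/-- Pure σ-representability is invariant under star isomorphisms. -/
theorem IsPurelySigmaRepresentable.of_equiv {B : Type u} [CommCStarAlgebra B] [PartialOrder B]
    [StarOrderedRing B] (hA : IsPurelySigmaRepresentable A) (e : B ≃⋆ₐ[ℂ] A) :
    IsPurelySigmaRepresentable B := by
  refine isPurelySigmaRepresentable_iff.mpr fun x hx h => ?_
  have hmono : Monotone e := OrderHomClass.mono e
  have h0 := hmono hx
  rw [map_zero] at h0
  have := isPurelySigmaRepresentable_iff.mp hA (e x) h0 fun χ => h (SigmaSpectrum.comap e χ)
  exact (map_eq_zero_iff e e.injective).mp this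

end SigmaGelfand

/-! ### The spectrum functor and the formal part of the dualities -/

/-- Star isomorphic algebras are isomorphic in the category of σ-cpu maps. -/
def CommSigmaCStar.isoOfStarAlgEquiv {A B : CommSigmaCStar.{u}} (e : A ≃⋆ₐ[ℂ] B) : A ≅ B where
  hom := SigmaCPUMap.ofStarAlgEquiv e
  inv := SigmaCPUMap.ofStarAlgEquiv e.symm
  hom_inv_id := SigmaCPUMap.ext fun a => e.symm_apply_apply a
  inv_hom_id := SigmaCPUMap.ext fun a => e.apply_symm_apply a

/-- The Gelfand σ-transform as an isomorphism to the Koopman algebra of the σ-spectrum. -/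
def gelfandIso (A : CommSigmaCStar.{u}) (hA : CommSigmaCStar.isPure A) :
    A ≅ koopman.obj (.op (specStoch A)) :=
  CommSigmaCStar.isoOfStarAlgEquiv (B := koopman.obj (.op (specStoch A)))
    (sigmaGelfandEquiv (A := A.carrier) hA A.isSigmaComplete)

/-- The action of the Gelfand σ-spectrum on σ-cpu maps. -/
def specAction : SpecAction.{u} where
  map {A B} φ := (koopman.preimage
    ((gelfandIso A.obj A.property).inv ≫ φ.hom ≫ (gelfandIso B.obj B.property).hom)).unop
  map_id A := by
    refine Quiver.Hom.op_inj (koopman.map_injective ?_)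
    rw [Quiver.Hom.op_unop, koopman.map_preimage, op_id, koopman.map_id,
      ObjectProperty.FullSubcategory.id_hom, Category.id_comp, Iso.inv_hom_id]
  map_comp {A B C} φ ψ := by
    refine Quiver.Hom.op_inj (koopman.map_injective ?_)
    rw [op_comp, koopman.map_comp]
    simp only [Quiver.Hom.op_unop, koopman.map_preimage, ObjectProperty.FullSubcategory.comp_hom,
      Category.assoc, Iso.hom_inv_id_assoc]
  integral_map {A B} φ ψ a := by
    have h := koopman.map_preimage
      ((gelfandIso A.obj A.property).inv ≫ φ.hom ≫ (gelfandIso B.obj B.property).hom)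
    -- Moving the inverse across turns the defining equation of the kernel into the naturality
    -- square of the Gelfand transform; its value at `a` and `ψ` is the integral formula.
    have h1 := (Iso.eq_inv_comp _).mp h
    have h2 := congrArg (fun f : SigmaCPUMap A.obj.carrier (Linf (SigmaSpectrum B.obj.carrier)) =>
      f a ψ) h1
    exact h2

/-- Naturality of the inverse Gelfand isomorphisms; with full faithfulness of `koopman` this is all
that the equivalences require. -/
theorem specAction_map_comp_gelfandIso {A B : CommSigmaCStar.isPure.{u}.FullSubcategory}
    (φ : A ⟶ B) : koopman.map (specAction.map φ).op ≫ (gelfandIso B.obj B.property).inv =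
      (gelfandIso A.obj A.property).inv ≫ φ.hom := by
  have h : koopman.map (specAction.map φ).op = _ := koopman.map_preimage
    ((gelfandIso A.obj A.property).inv ≫ φ.hom ≫ (gelfandIso B.obj B.property).hom)
  rw [h]
  simp

/-- A fully faithful functor with a right quasi-inverse is an equivalence. -/
theorem CategoryTheory.Functor.exists_equivalence_of_comp_iso {C : Type*} {D : Type*} [Category* C]
    [Category* D] (F : C ⥤ D) [F.Full] [F.Faithful] (G : D ⥤ C) (ε : G ⋙ F ≅ 𝟭 D) :
    ∃ e : C ≌ D, e.functor = F ∧ e.inverse = G := by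
  -- The unit at X is the preimage under F of the inverse of ε at F X; no construction inside `C` is
  -- needed.
  let η : 𝟭 C ≅ F ⋙ G := NatIso.ofComponents (fun X => F.preimageIso (ε.app (F.obj X)).symm)
    fun {X Y} f => F.map_injective (by
      have := ε.inv.naturality (F.map f)
      simpa using this)
  exact ⟨Equivalence.mk F G η ε, rfl, rfl⟩

theorem isPure_koopman (X : Stoch.{u}ᵒᵖ) : CommSigmaCStar.isPure (koopman.obj X) :=
  Linf.isPurelySigmaRepresentable X.unop.obj

theorem exists_duality : ∃ e : Stoch.{u}ᵒᵖ ≌ CommSigmaCStar.isPure.{u}.FullSubcategory,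
    e.functor = CommSigmaCStar.isPure.lift koopman isPure_koopman ∧
      e.inverse = specAction.functor.rightOp := by
  refine Functor.exists_equivalence_of_comp_iso _ _ (NatIso.ofComponents
    (fun A => CommSigmaCStar.isPure.isoMk (gelfandIso A.obj A.property).symm) fun {A B} φ => ?_)
  exact InducedCategory.hom_ext (specAction_map_comp_gelfandIso φ)

/-- The subcategories are full, so restricting the duality only requires checks on objects. -/
theorem restrictsToDuality (P : ObjectProperty Stoch.{u}) (Q : ObjectProperty CommSigmaCStar.{u})
    (hQ : Q ≤ CommSigmaCStar.isPure) (hL : ∀ X : Stoch.{u}, P X → Q (koopman.obj (.op X)))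
    (hS : ∀ A : CommSigmaCStar.{u}, Q A → P (specStoch A)) :
    RestrictsToDuality P Q specAction := by
  refine ⟨hQ, fun X => hL _ X.unop.property, fun A => hS _ A.unop.property, ?_⟩
  have : (Q.lift (P.ι.op ⋙ koopman) fun X => hL _ X.unop.property).Full := inferInstance
  refine Functor.exists_equivalence_of_comp_iso _ _ (NatIso.ofComponents
    (fun A => Q.isoMk (gelfandIso A.obj (hQ _ A.property)).symm) fun {A B} φ => ?_)
  exact InducedCategory.hom_ext (specAction_map_comp_gelfandIso ((ObjectProperty.ιOfLE hQ).map φ))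

open scoped InnerProductSpace

/-! ### Monotone convergence of operators -/

section MonotoneConvergence

variable {H : Type u} [NormedAddCommGroup H] [InnerProductSpace ℂ H]

theorem ContinuousLinearMap.le_iff_inner_le {S T : H →L[ℂ] H} :
    S ≤ T ↔ ∀ ξ, ⟪ξ, S ξ⟫_ℂ ≤ ⟪ξ, T ξ⟫_ℂ := by
  rw [ContinuousLinearMap.le_def]
  constructor
  · intro h ξ
    have := h.inner_nonneg_right ξ
    rwa [sub_apply, inner_sub_right, sub_nonneg] at this
  · intro h
    refine (ContinuousLinearMap.isPositive_iff_complex _).mpr fun ξ => ?_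
    have h1 : 0 ≤ ⟪(T - S) ξ, ξ⟫_ℂ := by
      have := sub_nonneg.mpr (h ξ)
      rw [← inner_sub_right, ← sub_apply] at this
      rw [← inner_conj_symm]
      exact star_nonneg_iff.mpr this
    have h2 := Complex.le_def.mp h1
    exact ⟨Complex.ext rfl h2.2, h2.1⟩

theorem ContinuousLinearMap.ext_inner_map_self {S T : H →L[ℂ] H}
    (h : ∀ ξ, ⟪ξ, S ξ⟫_ℂ = ⟪ξ, T ξ⟫_ℂ) : S = T :=
  le_antisymm (ContinuousLinearMap.le_iff_inner_le.mpr fun ξ => (h ξ).le)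
    (ContinuousLinearMap.le_iff_inner_le.mpr fun ξ => (h ξ).ge)

variable [CompleteSpace H]

/-- Writing T = S⋆S gives ‖Tξ‖ ≤ ‖S‖‖Sξ‖, while ‖Sξ‖² = ⟪ξ, Tξ⟫ and ‖S‖² = ‖T‖. It upgrades
convergence of quadratic forms to strong convergence. -/
theorem ContinuousLinearMap.norm_apply_sq_le {T : H →L[ℂ] H} (hT : 0 ≤ T) (ξ : H) :
    ‖T ξ‖ ^ 2 ≤ ‖T‖ * (⟪ξ, T ξ⟫_ℂ).re := by
  obtain ⟨S, rfl⟩ := CStarAlgebra.nonneg_iff_eq_star_mul_self.mp hT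
  have h1 : ⟪ξ, (star S * S) ξ⟫_ℂ = (‖S ξ‖ : ℂ) ^ 2 := by
    exact (ContinuousLinearMap.adjoint_inner_right S ξ (S ξ)).trans (inner_self_eq_norm_sq_to_K _)
  have h2 : ‖(star S * S) ξ‖ ≤ ‖S‖ * ‖S ξ‖ := by
    rw [← norm_star S]
    exact (star S).le_opNorm (S ξ)
  rw [h1, CStarRing.norm_star_mul_self, ← Complex.ofReal_pow, Complex.ofReal_re]
  calc _ ≤ (‖S‖ * ‖S ξ‖) ^ 2 := by gcongr
    _ = _ := by ring

/-- A norm-bounded increasing sequence of operators converges strongly. -/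
theorem ContinuousLinearMap.exists_tendsto_of_monotone {a : ℕ → H →L[ℂ] H} (hm : Monotone a)
    {C : ℝ} (hC : ∀ n, ‖a n‖ ≤ C) :
    ∃ s : H →L[ℂ] H, ∀ ξ, Tendsto (fun n => a n ξ) atTop (𝓝 (s ξ)) := by
  have hcauchy : ∀ ξ, CauchySeq fun n => a n ξ := by
    intro ξ
    have hmono : Monotone fun n => (⟪ξ, a n ξ⟫_ℂ).re := fun i j hij =>
      (Complex.le_def.mp (ContinuousLinearMap.le_iff_inner_le.mp (hm hij) ξ)).1
    have hbd : BddAbove (Set.range fun n => (⟪ξ, a n ξ⟫_ℂ).re) := by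
      refine ⟨‖ξ‖ * (C * ‖ξ‖), ?_⟩
      rintro _ ⟨n, rfl⟩
      refine (Complex.re_le_norm _).trans ((norm_inner_le_norm _ _).trans ?_)
      gcongr
      exact (a n).le_of_opNorm_le (hC n) ξ
    have hc := (tendsto_atTop_ciSup hmono hbd).cauchySeq
    have hC0 : 0 ≤ C := (norm_nonneg _).trans (hC 0)
    have hsq : ∀ i j, i ≤ j → ‖a j ξ - a i ξ‖ ^ 2 ≤
        (2 * C) * ((⟪ξ, a j ξ⟫_ℂ).re - (⟪ξ, a i ξ⟫_ℂ).re) := by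
      intro i j hij
      have h := ContinuousLinearMap.norm_apply_sq_le (sub_nonneg.mpr (hm hij)) ξ
      rw [sub_apply, inner_sub_right, Complex.sub_re] at h
      refine h.trans (mul_le_mul_of_nonneg_right ?_ (sub_nonneg.mpr (hmono hij)))
      refine (norm_sub_le _ _).trans ?_
      linarith [hC i, hC j]
    rw [Metric.cauchySeq_iff'] at hc ⊢
    intro ε hε
    -- By `hsq` the squared distance is at most 2C times the gap of the quadratic form; the extra 1
    -- keeps the denominator positive when C = 0.
    obtain ⟨N, hN⟩ := hc (ε ^ 2 / (2 * C + 1)) (by positivity)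
    refine ⟨N, fun n hn => ?_⟩
    have h1 := hN n hn
    rw [Real.dist_eq, lt_div_iff₀ (by positivity)] at h1
    have h2 := hsq N n hn
    have h3 := le_abs_self ((⟪ξ, a n ξ⟫_ℂ).re - (⟪ξ, a N ξ⟫_ℂ).re)
    have h4 := abs_nonneg ((⟪ξ, a n ξ⟫_ℂ).re - (⟪ξ, a N ξ⟫_ℂ).re)
    rw [dist_eq_norm]
    refine lt_of_pow_lt_pow_left₀ 2 hε.le ?_
    nlinarith
  choose f hf using fun ξ => cauchySeq_tendsto_of_complete (hcauchy ξ)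
  exact ⟨continuousLinearMapOfTendsto a (f := f) (tendsto_pi_nhds.mpr hf), hf⟩

theorem ContinuousLinearMap.increasesTo_of_tendsto {a : ℕ → H →L[ℂ] H} {s : H →L[ℂ] H}
    (hsa : ∀ n, IsSelfAdjoint (a n)) (hm : Monotone a)
    (h : ∀ ξ, Tendsto (fun n => ⟪ξ, a n ξ⟫_ℂ) atTop (𝓝 ⟪ξ, s ξ⟫_ℂ)) : IncreasesTo a s where
  isSelfAdjoint := hsa
  monotone := hm
  isLUB := by
    refine ⟨?_, fun b hb => ?_⟩
    · rintro _ ⟨n, rfl⟩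
      refine ContinuousLinearMap.le_iff_inner_le.mpr fun ξ => ?_
      exact Monotone.ge_of_tendsto
        (fun i j hij => ContinuousLinearMap.le_iff_inner_le.mp (hm hij) ξ) (h ξ) n
    · refine ContinuousLinearMap.le_iff_inner_le.mpr fun ξ => ?_
      exact le_of_tendsto' (h ξ) fun n => ContinuousLinearMap.le_iff_inner_le.mp (hb ⟨n, rfl⟩) ξ

/-- The norm is monotone on positive elements, and 0 ≤ a n − a 0 ≤ s − a 0. -/
theorem IncreasesTo.norm_le {A : Type u} [CStarAlgebra A] [PartialOrder A] [StarOrderedRing A]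
    {a : ℕ → A} {s : A} (h : IncreasesTo a s) (n : ℕ) : ‖a n‖ ≤ ‖s - a 0‖ + ‖a 0‖ := by
  have h1 : ‖a n - a 0‖ ≤ ‖s - a 0‖ :=
    CStarAlgebra.norm_le_norm_of_nonneg_of_le (sub_nonneg.mpr (h.monotone (Nat.zero_le n)))
      (sub_le_sub_right (h.isLUB.1 ⟨n, rfl⟩) _)
  calc ‖a n‖ = ‖(a n - a 0) + a 0‖ := by rw [sub_add_cancel]
    _ ≤ _ := (norm_add_le _ _).trans (by gcongr)

/-- An increasing sequence of operators converges strongly to its supremum. -/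
theorem IncreasesTo.tendsto_apply {a : ℕ → H →L[ℂ] H} {s : H →L[ℂ] H} (h : IncreasesTo a s)
    (ξ : H) : Tendsto (fun n => a n ξ) atTop (𝓝 (s ξ)) := by
  obtain ⟨t, ht⟩ := ContinuousLinearMap.exists_tendsto_of_monotone h.monotone h.norm_le
  have h1 := ContinuousLinearMap.increasesTo_of_tendsto h.isSelfAdjoint h.monotone
    (s := t) fun ξ => tendsto_const_nhds.inner (ht ξ)
  rw [h.isLUB.unique h1.isLUB]
  exact ht ξ

end MonotoneConvergence

/-! ### States and faithfulness of the universal representation -/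

section UniversalRepresentationFacts

variable {A : Type u} [CStarAlgebra A] [PartialOrder A] [StarOrderedRing A]

/-- The closed convex cone of positive elements. -/
def CStarAlgebra.positiveCone (A : Type u) [CStarAlgebra A] [PartialOrder A] [StarOrderedRing A] :
    ProperCone ℝ A where
  toSubmodule := PointedCone.positive ℝ A
  isClosed' := CStarAlgebra.isClosed_nonneg

/-- Hahn–Banach: a real functional separates `a` from the closed positive cone, and it is extended
complex-linearly through real and imaginary parts. -/
theorem exists_positiveLinearMap_re_neg {a : A} (ha : IsSelfAdjoint a) (h : ¬ 0 ≤ a) :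
    ∃ φ : A →ₚ[ℂ] ℂ, (φ a).re < 0 := by
  obtain ⟨f, hf, hfa⟩ := (CStarAlgebra.positiveCone A).hyperplane_separation_point
    (x₀ := a) h
  let φ : A →ₗ[ℂ] ℂ :=
    { toFun := fun b => (f (realPart b) : ℂ) + Complex.I * f (imaginaryPart b)
      map_add' := fun b c => by
        simp only [map_add, AddSubgroup.coe_add]; push_cast; ring
      map_smul' := fun c b => by
        simp only [realPart_smul, imaginaryPart_smul, selfAdjoint.val_smul,
          AddSubgroup.coe_add, AddSubgroup.coe_sub, map_add, map_sub, map_smul, smul_eq_mul,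
          RingHom.id_apply]
        apply Complex.ext <;> simp }
  have hφ : ∀ b, IsSelfAdjoint b → φ b = f b := fun b hb => by
    change (f (realPart b) : ℂ) + Complex.I * f (imaginaryPart b) = f b
    rw [hb.coe_realPart, hb.imaginaryPart]
    simp
  refine ⟨PositiveLinearMap.mk₀ φ fun b hb => ?_, ?_⟩
  · rw [hφ b (IsSelfAdjoint.of_nonneg hb)]
    exact Complex.zero_le_real.mpr (hf b hb)
  · change (φ a).re < 0
    rw [hφ a ha]
    exact hfa

theorem exists_state_re_neg {a : A} (ha : IsSelfAdjoint a) (h : ¬ 0 ≤ a) :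
    ∃ φ : A →ₚ[ℂ] ℂ, φ 1 = 1 ∧ (φ a).re < 0 := by
  obtain ⟨φ, hφ⟩ := exists_positiveLinearMap_re_neg ha h
  have h1 : 0 ≤ φ 1 := map_nonneg φ zero_le_one
  have hr := Complex.le_def.mp h1
  have h1' : φ 1 = ((φ 1).re : ℂ) := Complex.ext rfl hr.2.symm
  -- If φ(1) were 0, this inequality would give φ(−a) ≤ 0, contrary to φ(a) < 0. Hence φ can be
  -- normalized to a state.
  have hle : -a ≤ ‖a‖ • (1 : A) := by
    rw [← norm_neg a, ← Algebra.algebraMap_eq_smul_one]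
    exact ha.neg.le_algebraMap_norm_self
  have h2 : 0 < (φ 1).re := by
    refine lt_of_le_of_ne hr.1 fun h0 => ?_
    have := Complex.le_def.mp (OrderHomClass.mono φ hle)
    rw [map_neg, ← Complex.coe_smul, map_smul, h1', ← h0] at this
    simp at this
    linarith [this.1]
  have h2' : (0 : ℂ) ≤ ((φ 1).re⁻¹ : ℝ) := Complex.zero_le_real.mpr (inv_nonneg.mpr h2.le)
  refine ⟨PositiveLinearMap.mk₀ ((((φ 1).re⁻¹ : ℝ) : ℂ) • φ.toLinearMap) fun b hb =>
    mul_nonneg h2' (map_nonneg φ hb), ?_, ?_⟩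
  · change (((φ 1).re⁻¹ : ℝ) : ℂ) * φ 1 = 1
    rw [h1', ← Complex.ofReal_mul, Complex.ofReal_re, inv_mul_cancel₀ h2.ne', Complex.ofReal_one]
  · change ((((φ 1).re⁻¹ : ℝ) : ℂ) * φ a).re < 0
    rw [Complex.re_ofReal_mul]
    exact mul_neg_of_pos_of_neg (inv_pos.mpr h2) hφ

/-- Every state is a vector state of the universal representation. -/
theorem exists_inner_universalRep (φ : A →ₚ[ℂ] ℂ) (hφ : φ 1 = 1) :
    ∃ ξ : UnivHilbert A, ∀ a, ⟪ξ, universalRep A a ξ⟫_ℂ = φ a := by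
  classical
  let i : {φ : A →ₚ[ℂ] ℂ // φ 1 = 1} := ⟨φ, hφ⟩
  -- The vector is the GNS cyclic vector, the class of 1, placed in the summand indexed by φ itself.
  refine ⟨lp.single 2 i ((φ.toPreGNS 1 : φ.PreGNS) : φ.GNS), fun a => ?_⟩
  rw [lp.inner_single_left]
  change ⟪_, universalRepFun a _ i⟫_ℂ = _
  rw [universalRepFun_apply, lp.single_apply_self]
  change ⟪((φ.toPreGNS 1 : φ.PreGNS) : φ.GNS), φ.gnsNonUnitalStarAlgHom a _⟫_ℂ = _
  rw [PositiveLinearMap.gnsNonUnitalStarAlgHom_apply_coe, UniformSpace.Completion.inner_coe,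
    PositiveLinearMap.preGNS_inner_def]
  simp

/-- For a ≠ 0 some state is negative on −a⋆a, but that state is a vector state of the representation
and would vanish there if `a` were in the kernel. -/
theorem universalRep_injective : Function.Injective (universalRep A) := by
  refine (injective_iff_map_eq_zero _).mpr fun a ha => ?_
  by_contra hne
  have hneg : ¬ 0 ≤ -(star a * a) := fun h =>
    hne ((CStarRing.star_mul_self_eq_zero_iff a).mp
      (le_antisymm (neg_nonneg.mp h) (star_mul_self_nonneg a)))
  obtain ⟨φ, hφ1, hφ⟩ := exists_state_re_neg (IsSelfAdjoint.star_mul_self a).neg hneg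
  obtain ⟨ξ, hξ⟩ := exists_inner_universalRep φ hφ1
  have h := hξ (-(star a * a))
  rw [map_neg, map_mul, ha, mul_zero, neg_zero] at h
  rw [← h] at hφ
  simp at hφ

end UniversalRepresentationFacts

/-! ### Baire σ-algebras and Baire measures on compact spaces -/

/-- The σ-algebra of a topological space is its Baire σ-algebra. -/
class BaireMeasurable (K : Type u) [TopologicalSpace K] [m : MeasurableSpace K] : Prop where
  eq_iSup : m = ⨆ f : C(K, ℝ), (borel ℝ).comap f

section Baire

variable {K : Type u} [TopologicalSpace K] [m : MeasurableSpace K] [BaireMeasurable K]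

theorem ContinuousMap.measurable_real_of_baire (f : C(K, ℝ)) : Measurable f := by
  refine Measurable.of_comap_le ?_
  rw [BaireMeasurable.eq_iSup (K := K)]
  exact le_iSup (fun f : C(K, ℝ) => (borel ℝ).comap f) f

theorem ContinuousMap.measurable_complex_of_baire (f : C(K, ℂ)) : Measurable f := by
  have h1 := measurable_real_of_baire (⟨fun x => (f x).re, by fun_prop⟩ : C(K, ℝ))
  have h2 := measurable_real_of_baire (⟨fun x => (f x).im, by fun_prop⟩ : C(K, ℝ))
  have h3 : (f : K → ℂ) = fun x => ((f x).re : ℂ) + (f x).im * Complex.I :=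
    funext fun x => (Complex.re_add_im _).symm
  rw [h3]
  exact (Complex.measurable_ofReal.comp h1).add
    ((Complex.measurable_ofReal.comp h2).mul measurable_const)

theorem measurable_of_forall_continuousMap {Y : Type*} [MeasurableSpace Y] {g : Y → K}
    (h : ∀ f : C(K, ℝ), Measurable fun y => f (g y)) : Measurable g := by
  refine measurable_iff_comap_le.mpr ?_
  rw [BaireMeasurable.eq_iSup (K := K), MeasurableSpace.comap_iSup]
  refine iSup_le fun f => ?_
  rw [MeasurableSpace.comap_comp]
  exact (h f).comap_le

variable [CompactSpace K]

/-- Continuous functions are bounded measurable functions. -/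
def Linf.ofContinuous : C(K, ℂ) →⋆ₐ[ℂ] Linf K where
  toFun f := Linf.mk f f.measurable_complex_of_baire ‖f‖ f.norm_coe_le_norm
  map_one' := rfl
  map_mul' _ _ := rfl
  map_zero' := rfl
  map_add' _ _ := rfl
  commutes' _ := rfl
  map_star' _ := rfl

/-- A σ-closed subspace which contains the continuous functions is everything. -/
theorem Linf.eq_top_of_continuous (V : Submodule ℂ (Linf K)) (hV : V.IsSigmaClosed)
    (h : ∀ f : C(K, ℂ), Linf.ofContinuous f ∈ V) : V = ⊤ := by
  refine Linf.eq_top_of_generating V hV (map_one (Linf.ofContinuous (K := K)) ▸ h 1)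
    (Set.range Linf.ofContinuous) ?_ ?_ ?_ ?_
  · rintro _ ⟨f, rfl⟩
    exact h f
  · rintro _ ⟨f, rfl⟩ _ ⟨g, rfl⟩
    exact ⟨f * g, rfl⟩
  · rintro _ ⟨f, rfl⟩ g
    exact ⟨_, ⟨g.comp f, rfl⟩, fun x => rfl⟩
  · refine (BaireMeasurable.eq_iSup (K := K)).le.trans (iSup_le fun f => ?_)
    refine le_iSup₂_of_le (Linf.ofContinuous ⟨fun x => (f x : ℂ), by fun_prop⟩) ⟨_, rfl⟩ ?_
    calc (borel ℝ).comap f = ((borel ℝ).comap Complex.re).comap (fun x => (f x : ℂ)) := by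
          rw [MeasurableSpace.comap_comp]; rfl
      _ ≤ _ := MeasurableSpace.comap_mono Complex.measurable_re.comap_le

theorem Linf.eq_of_ofContinuous {B : Type v} [CStarAlgebra B] [PartialOrder B]
    {φ ψ : Linf K →ₗ[ℂ] B} (hφ : IsSigmaNormal φ) (hψ : IsSigmaNormal ψ)
    (h : ∀ f : C(K, ℂ), φ (Linf.ofContinuous f) = ψ (Linf.ofContinuous f)) : φ = ψ := by
  have := Linf.eq_top_of_continuous _ (LinearMap.isSigmaClosed_eqLocus hφ hψ) h
  exact LinearMap.ext fun a => (this ▸ Submodule.mem_top : a ∈ LinearMap.eqLocus φ ψ)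

theorem exists_measure_of_borelSpace {K : Type u} [TopologicalSpace K] [CompactSpace K] [T2Space K]
    [MeasurableSpace K] [BorelSpace K] (Λ : C(K, ℝ) →ₗ[ℝ] ℝ) (hΛ : ∀ f, 0 ≤ f → 0 ≤ Λ f) :
    ∃ μ : Measure K, IsFiniteMeasure μ ∧ ∀ f : C(K, ℝ), ∫ x, f x ∂μ = Λ f := by
  let Λ' : CompactlySupportedContinuousMap K ℝ →ₚ[ℝ] ℝ := PositiveLinearMap.mk₀
    { toFun := fun f => Λ f.toContinuousMap
      map_add' := fun f g => map_add Λ f.toContinuousMap g.toContinuousMap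
      map_smul' := fun c f => map_smul Λ c f.toContinuousMap }
    fun f hf => hΛ _ hf
  refine ⟨RealRMK.rieszMeasure Λ', inferInstance, fun f => ?_⟩
  exact RealRMK.integral_rieszMeasure Λ' ⟨f, HasCompactSupport.of_compactSpace _⟩

variable [T2Space K]

/-- The homeomorphic copy `L` carries the Borel σ-algebra and `K` the Baire one. Pushing the Riesz
measure forward along `e` restricts it to Baire sets without two σ-algebras on one type. -/
theorem exists_measure_of_homeomorph {L : Type u} [TopologicalSpace L] [MeasurableSpace L]
    [BorelSpace L] (e : L ≃ₜ K) (Λ : C(K, ℝ) →ₗ[ℝ] ℝ) (hΛ : ∀ f, 0 ≤ f → 0 ≤ Λ f) :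
    ∃ μ : Measure K, IsFiniteMeasure μ ∧ ∀ f : C(K, ℝ), ∫ x, f x ∂μ = Λ f := by
  have := e.symm.compactSpace
  have := e.symm.t2Space
  obtain ⟨ν, hν, h⟩ := exists_measure_of_borelSpace
    (Λ ∘ₗ (ContinuousMap.compRightAlgHom ℝ ℝ (e.symm : C(K, L))).toLinearMap) fun f hf => hΛ _ fun x =>
      hf (e.symm x)
  have he : Measurable e := measurable_of_forall_continuousMap fun f =>
    (f.continuous.comp e.continuous).measurable
  refine ⟨ν.map e, inferInstance, fun f => ?_⟩
  rw [integral_map he.aemeasurable f.measurable_real_of_baire.aestronglyMeasurable]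
  refine (h (f.comp e)).trans ?_
  change Λ _ = Λ _
  congr 1
  ext x
  exact congrArg f (e.apply_symm_apply x)

/-- The Riesz representation theorem for Baire measures on compact spaces. -/
theorem exists_measure_of_baire (Λ : C(K, ℝ) →ₗ[ℝ] ℝ) (hΛ : ∀ f, 0 ≤ f → 0 ≤ Λ f) :
    ∃ μ : Measure K, IsFiniteMeasure μ ∧ ∀ f : C(K, ℝ), ∫ x, f x ∂μ = Λ f :=
  @exists_measure_of_homeomorph K _ m _ _ _ K _ (borel K) (@BorelSpace.mk K _ (borel K) rfl)
    (Homeomorph.refl K) Λ hΛ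

end Baire

theorem Linf.tendsto_integral_mul {X : Type u} [MeasurableSpace X] {a : ℕ → Linf X} {s : Linf X}
    (h : IncreasesTo a s) (g : Linf X) (μ : Measure X) [IsFiniteMeasure μ] :
    Tendsto (fun n => ∫ x, (a n * g) x ∂μ) atTop (𝓝 (∫ x, (s * g) x ∂μ)) :=
  tendsto_integral_of_dominated_convergence (fun _ => (‖a 0‖ + ‖s‖) * ‖g‖)
    (fun n => (a n * g).measurable.aestronglyMeasurable) (integrable_const _)
    (fun n => ae_of_all _ fun x => by
      rw [Linf.mul_apply, norm_mul]
      gcongr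
      · exact ((a n).norm_apply_le x).trans (Linf.norm_le_of_increasesTo h n)
      · exact g.norm_apply_le x)
    (ae_of_all _ fun x => (Linf.tendsto_of_increasesTo h x).mul_const (g x))

theorem Linf.tendsto_integral {X : Type u} [MeasurableSpace X] {a : ℕ → Linf X} {s : Linf X}
    (h : IncreasesTo a s) (μ : Measure X) [IsFiniteMeasure μ] :
    Tendsto (fun n => ∫ x, a n x ∂μ) atTop (𝓝 (∫ x, s x ∂μ)) := by
  simpa using Linf.tendsto_integral_mul h 1 μ

/-! ### The Baire functional calculus -/

section Calculus

variable {K : Type u} [TopologicalSpace K] [MeasurableSpace K] [BaireMeasurable K] [CompactSpace K]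
  [T2Space K] {H : Type u} [NormedAddCommGroup H] [InnerProductSpace ℂ H] [CompleteSpace H]
  (σ : C(K, ℂ) →⋆ₐ[ℂ] (H →L[ℂ] H))

/-- Star homomorphisms preserve order, so f ↦ ⟪ξ, σ(f)ξ⟫ is a positive functional on real functions
and Riesz representation applies; complex functions follow by linearity. -/
theorem exists_spectralMeasure (ξ : H) : ∃ μ : Measure K, IsFiniteMeasure μ ∧
    ∀ f : C(K, ℂ), ∫ x, f x ∂μ = ⟪ξ, σ f ξ⟫_ℂ := by
  let j : C(K, ℝ) →L[ℝ] C(K, ℂ) := Complex.ofRealCLM.compLeftContinuous ℝ K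
  have hj : ∀ f x, j f x = (f x : ℂ) := fun f x => rfl
  have hreal : ∀ f, ⟪ξ, σ (j f) ξ⟫_ℂ = ((⟪ξ, σ (j f) ξ⟫_ℂ).re : ℂ) := fun f => by
    refine (Complex.conj_eq_iff_re.mp ?_).symm
    have h1 : star (j f) = j f := ContinuousMap.ext fun x => Complex.conj_ofReal _
    have h2 : star (σ (j f)) = σ (j f) := by rw [← map_star, h1]
    rw [inner_conj_symm]
    nth_rewrite 1 [← h2]
    exact ContinuousLinearMap.adjoint_inner_left _ _ _
  obtain ⟨μ, hμ, h⟩ := exists_measure_of_baire (K := K)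
    { toFun := fun f => (⟪ξ, σ (j f) ξ⟫_ℂ).re
      map_add' := fun f g => by
        rw [map_add, map_add, add_apply, inner_add_right, Complex.add_re]
      map_smul' := fun c f => by
        rw [map_smul, ← Complex.coe_smul, map_smul, smul_apply, inner_smul_right,
          Complex.re_ofReal_mul]
        rfl }
    (fun f hf => by
      have h1 : 0 ≤ j f := fun x => Complex.zero_le_real.mpr (hf x)
      have h2 := ContinuousLinearMap.le_iff_inner_le.mp (map_nonneg σ h1) ξ
      simpa using (Complex.le_def.mp h2).1)
  refine ⟨μ, hμ, fun f => ?_⟩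
  let p : C(K, ℝ) := ⟨fun x => (f x).re, by fun_prop⟩
  let q : C(K, ℝ) := ⟨fun x => (f x).im, by fun_prop⟩
  have hf : f = j p + Complex.I • j q := ContinuousMap.ext fun x => by
    simp [hj, p, q, mul_comm Complex.I, Complex.re_add_im]
  have hint : ∀ g : C(K, ℝ), Integrable (fun x => (g x : ℂ)) μ := fun g =>
    (Linf.ofContinuous (j g)).integrable μ
  have hval : ∀ g : C(K, ℝ), ∫ x, (g x : ℂ) ∂μ = ⟪ξ, σ (j g) ξ⟫_ℂ := fun g => by
    rw [hreal, integral_complex_ofReal]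
    exact congrArg _ (h g)
  rw [hf, map_add, map_smul, add_apply, smul_apply, inner_add_right, inner_smul_right, ← hval,
    ← hval, ← integral_const_mul, ← integral_add (hint p) ((hint q).const_mul _)]
  rfl

/-- The Baire measure on `K` which represents the vector functional of `ξ`. -/
def spectralMeasure (ξ : H) : Measure K := (exists_spectralMeasure σ ξ).choose

instance (ξ : H) : IsFiniteMeasure (spectralMeasure σ ξ) :=
  (exists_spectralMeasure σ ξ).choose_spec.1

theorem integral_spectralMeasure (ξ : H) (f : C(K, ℂ)) :
    ∫ x, f x ∂(spectralMeasure σ ξ) = ⟪ξ, σ f ξ⟫_ℂ :=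
  (exists_spectralMeasure σ ξ).choose_spec.2 f

/-- The functions that have such an operator form a σ-closed subspace containing C(K): operators of
an increasing sequence increase with bounded norms, and their strong limit represents the limit by
dominated convergence. No polarized complex measures are needed. -/
theorem exists_baireCalculus (f : Linf K) :
    ∃ b : H →L[ℂ] H, ∀ ξ, ⟪ξ, b ξ⟫_ℂ = ∫ x, f x ∂(spectralMeasure σ ξ) := by
  let V : Submodule ℂ (Linf K) :=
    { carrier := {f | ∃ b : H →L[ℂ] H, ∀ ξ, ⟪ξ, b ξ⟫_ℂ = ∫ x, f x ∂(spectralMeasure σ ξ)}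
      add_mem' := by
        rintro f g ⟨b, hb⟩ ⟨c, hc⟩
        refine ⟨b + c, fun ξ => ?_⟩
        rw [add_apply, inner_add_right, hb, hc]
        exact (integral_add (f.integrable _) (g.integrable _)).symm
      zero_mem' := ⟨0, fun ξ => by simp⟩
      smul_mem' := by
        rintro c f ⟨b, hb⟩
        refine ⟨c • b, fun ξ => ?_⟩
        rw [smul_apply, inner_smul_right, hb]
        exact (integral_const_mul c _).symm }
  have hV : V.IsSigmaClosed := by
    intro a s ha h
    choose b hb using ha
    have hmono : Monotone b := fun i j hij => ContinuousLinearMap.le_iff_inner_le.mpr fun ξ => by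
      rw [hb, hb]
      exact integral_mono ((a i).integrable _) ((a j).integrable _) (h.monotone hij)
    -- The spectral measure of ξ has total mass ‖ξ‖², so a uniform bound on the functions gives an
    -- operator bound by a multiple of 1.
    have hle : ∀ n, b n ≤ ((‖a 0‖ + ‖s‖ : ℝ) : ℂ) • 1 := fun n =>
      ContinuousLinearMap.le_iff_inner_le.mpr fun ξ => by
        have h1 := integral_spectralMeasure σ ξ (((‖a 0‖ + ‖s‖ : ℝ) : ℂ) • 1)
        rw [map_smul, map_one] at h1
        rw [hb, ← h1]
        refine integral_mono ((a n).integrable _)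
          ((Linf.ofContinuous (((‖a 0‖ + ‖s‖ : ℝ) : ℂ) • 1)).integrable _) fun x => ?_
        have h2 := Linf.isSelfAdjoint_iff.mp (h.isSelfAdjoint n) x
        simp only [ContinuousMap.coe_smul, ContinuousMap.coe_one, Pi.smul_apply, Pi.one_apply,
          smul_eq_mul, mul_one]
        rw [h2]
        exact Complex.real_le_real.mpr ((Complex.re_le_norm _).trans
          (((a n).norm_apply_le x).trans (Linf.norm_le_of_increasesTo h n)))
    obtain ⟨t, ht⟩ := ContinuousLinearMap.exists_tendsto_of_monotone hmono
      (C := ‖((‖a 0‖ + ‖s‖ : ℝ) : ℂ) • 1 - b 0‖ + ‖b 0‖) fun n => by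
        have h1 : ‖b n - b 0‖ ≤ ‖((‖a 0‖ + ‖s‖ : ℝ) : ℂ) • 1 - b 0‖ :=
          CStarAlgebra.norm_le_norm_of_nonneg_of_le (sub_nonneg.mpr (hmono (Nat.zero_le n)))
            (sub_le_sub_right (hle n) _)
        calc ‖b n‖ = ‖(b n - b 0) + b 0‖ := by rw [sub_add_cancel]
          _ ≤ _ := (norm_add_le _ _).trans (by gcongr)
    refine ⟨t, fun ξ => tendsto_nhds_unique (tendsto_const_nhds.inner (ht ξ)) ?_⟩
    simp_rw [hb]
    exact Linf.tendsto_integral h _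
  have htop := Linf.eq_top_of_continuous V hV fun f =>
    ⟨σ f, fun ξ => (integral_spectralMeasure σ ξ f).symm⟩
  exact (htop ▸ Submodule.mem_top : f ∈ V)

/-- The operator obtained by integrating a bounded Baire function against the spectral measures. -/
def baireCalculusFun (f : Linf K) : H →L[ℂ] H := (exists_baireCalculus σ f).choose

theorem inner_baireCalculusFun (f : Linf K) (ξ : H) :
    ⟪ξ, baireCalculusFun σ f ξ⟫_ℂ = ∫ x, f x ∂(spectralMeasure σ ξ) :=
  (exists_baireCalculus σ f).choose_spec ξ

/-- The linear map underlying the Baire functional calculus. -/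
def baireCalculusLinear : Linf K →ₗ[ℂ] (H →L[ℂ] H) where
  toFun := baireCalculusFun σ
  map_add' f g := ContinuousLinearMap.ext_inner_map_self fun ξ => by
    rw [add_apply, inner_add_right, inner_baireCalculusFun, inner_baireCalculusFun,
      inner_baireCalculusFun]
    exact integral_add (f.integrable _) (g.integrable _)
  map_smul' c f := ContinuousLinearMap.ext_inner_map_self fun ξ => by
    rw [RingHom.id_apply, smul_apply, inner_smul_right, inner_baireCalculusFun,
      inner_baireCalculusFun]
    exact integral_const_mul c _

theorem inner_baireCalculusLinear (f : Linf K) (ξ : H) :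
    ⟪ξ, baireCalculusLinear σ f ξ⟫_ℂ = ∫ x, f x ∂(spectralMeasure σ ξ) :=
  inner_baireCalculusFun σ f ξ

theorem baireCalculusLinear_ofContinuous (f : C(K, ℂ)) :
    baireCalculusLinear σ (Linf.ofContinuous f) = σ f :=
  ContinuousLinearMap.ext_inner_map_self fun ξ => by
    rw [inner_baireCalculusLinear]
    exact integral_spectralMeasure σ ξ f

theorem baireCalculusLinear_star (f : Linf K) :
    baireCalculusLinear σ (star f) = star (baireCalculusLinear σ f) :=
  ContinuousLinearMap.ext_inner_map_self fun ξ => by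
    have h1 : ⟪ξ, star (baireCalculusLinear σ f) ξ⟫_ℂ = ⟪baireCalculusLinear σ f ξ, ξ⟫_ℂ :=
      ContinuousLinearMap.adjoint_inner_right _ _ _
    rw [inner_baireCalculusLinear, h1, ← inner_conj_symm, inner_baireCalculusLinear]
    exact integral_conj

theorem baireCalculusLinear_increasesTo {a : ℕ → Linf K} {s : Linf K} (h : IncreasesTo a s) :
    IncreasesTo (fun n => baireCalculusLinear σ (a n)) (baireCalculusLinear σ s) := by
  refine ContinuousLinearMap.increasesTo_of_tendsto (fun n => ?_) (fun i j hij => ?_) fun ξ => ?_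
  · rw [isSelfAdjoint_iff, ← baireCalculusLinear_star, (h.isSelfAdjoint n).star_eq]
  · refine ContinuousLinearMap.le_iff_inner_le.mpr fun ξ => ?_
    rw [inner_baireCalculusLinear, inner_baireCalculusLinear]
    exact integral_mono ((a i).integrable _) ((a j).integrable _) (h.monotone hij)
  · simp_rw [inner_baireCalculusLinear]
    exact Linf.tendsto_integral h _

/-- For fixed `g` both sides are σ-continuous in `f`: the left by dominated convergence, the right
because increasing operators converge strongly on the vector obtained from `g`. -/
theorem baireCalculusLinear_mul_of_continuous (g : Linf K)
    (hg : ∀ f : C(K, ℂ), baireCalculusLinear σ (Linf.ofContinuous f * g) =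
      σ f * baireCalculusLinear σ g) (f : Linf K) :
    baireCalculusLinear σ (f * g) = baireCalculusLinear σ f * baireCalculusLinear σ g := by
  let V : Submodule ℂ (Linf K) := LinearMap.eqLocus
    (baireCalculusLinear σ ∘ₗ LinearMap.mulRight ℂ g)
    (LinearMap.mulRight ℂ (baireCalculusLinear σ g) ∘ₗ baireCalculusLinear σ)
  have hV : V.IsSigmaClosed := by
    intro a s ha h
    refine ContinuousLinearMap.ext_inner_map_self fun ξ => ?_
    have h1 : Tendsto (fun n => ⟪ξ, baireCalculusLinear σ (a n * g) ξ⟫_ℂ) atTop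
        (𝓝 ⟪ξ, baireCalculusLinear σ (s * g) ξ⟫_ℂ) := by
      simp_rw [inner_baireCalculusLinear]
      exact Linf.tendsto_integral_mul h g _
    have h2 : Tendsto (fun n => ⟪ξ, baireCalculusLinear σ (a n) (baireCalculusLinear σ g ξ)⟫_ℂ)
        atTop (𝓝 ⟪ξ, baireCalculusLinear σ s (baireCalculusLinear σ g ξ)⟫_ℂ) :=
      tendsto_const_nhds.inner ((baireCalculusLinear_increasesTo σ h).tendsto_apply _)
    refine tendsto_nhds_unique h1 (h2.congr fun n => ?_)
    have h3 : baireCalculusLinear σ (a n * g) =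
      baireCalculusLinear σ (a n) * baireCalculusLinear σ g := ha n
    rw [h3]
    rfl
  have htop := Linf.eq_top_of_continuous V hV fun f => by
    change _ = baireCalculusLinear σ (Linf.ofContinuous f) * _
    rw [baireCalculusLinear_ofContinuous]
    exact hg f
  exact (htop ▸ Submodule.mem_top : f ∈ V)

theorem baireCalculusLinear_mul (f g : Linf K) :
    baireCalculusLinear σ (f * g) = baireCalculusLinear σ f * baireCalculusLinear σ g := by
  have h1 : ∀ (g : C(K, ℂ)) (f : Linf K), baireCalculusLinear σ (f * Linf.ofContinuous g) =
      baireCalculusLinear σ f * σ g := fun g f => by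
    rw [← baireCalculusLinear_ofContinuous]
    refine baireCalculusLinear_mul_of_continuous σ _ (fun f' => ?_) f
    rw [← map_mul, baireCalculusLinear_ofContinuous, baireCalculusLinear_ofContinuous, map_mul]
  -- Monotone extension acts on the left factor only. By `h1` the right factor may be continuous
  -- with the left arbitrary; taking adjoints exchanges the two, which is the hypothesis for
  -- arbitrary `g`.
  refine baireCalculusLinear_mul_of_continuous σ g (fun f' => star_injective ?_) f
  rw [← baireCalculusLinear_star, star_mul, star_mul, ← map_star Linf.ofContinuous, ← map_star σ, h1,
    baireCalculusLinear_star]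

/-- The Baire functional calculus of a representation of the continuous functions. -/
def baireCalculus : Linf K →⋆ₐ[ℂ] (H →L[ℂ] H) where
  __ := AlgHom.ofLinearMap (baireCalculusLinear σ)
    (by rw [← map_one Linf.ofContinuous, baireCalculusLinear_ofContinuous, map_one])
    (baireCalculusLinear_mul σ)
  map_star' := baireCalculusLinear_star σ

theorem range_baireCalculus_subset :
    Set.range (baireCalculus σ) ⊆ sigmaClosure (Set.range σ) := by
  rintro _ ⟨f, rfl⟩ V hσV _ hV
  have htop := Linf.eq_top_of_continuous (V.comap (baireCalculusLinear σ))
    (fun a s ha h => hV _ _ ha (baireCalculusLinear_increasesTo σ h)) fun f => by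
      rw [Submodule.mem_comap, baireCalculusLinear_ofContinuous]
      exact hσV ⟨f, rfl⟩
  exact (htop ▸ Submodule.mem_top : f ∈ V.comap (baireCalculusLinear σ))

variable {σ} {v : K → H} (hv : ∀ x (f : C(K, ℂ)), ⟪v x, σ f (v x)⟫_ℂ = f x)

include hv

/-- The vectors `v x` recover function values from operators: both sides are σ-normal in `f` and
agree on C(K). This yields injectivity and reflection of order. -/
theorem inner_baireCalculus_self (f : Linf K) (x : K) : ⟪v x, baireCalculus σ f (v x)⟫_ℂ = f x := by
  let V : Submodule ℂ (Linf K) := LinearMap.eqLocus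
    ((innerSL ℂ (v x)).toLinearMap ∘ₗ (LinearMap.applyₗ (v x)) ∘ₗ
      (ContinuousLinearMap.coeLM ℂ) ∘ₗ baireCalculusLinear σ)
    (Linf.eval x : Linf K →ₐ[ℂ] ℂ).toLinearMap
  have htop := Linf.eq_top_of_continuous V (fun a s ha h => by
      refine tendsto_nhds_unique (tendsto_const_nhds.inner
        ((baireCalculusLinear_increasesTo σ h).tendsto_apply (v x))) ?_
      exact (Linf.tendsto_of_increasesTo h x).congr fun n => (ha n).symm) fun f => by
    change ⟪v x, baireCalculusLinear σ (Linf.ofContinuous f) (v x)⟫_ℂ = f x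
    rw [baireCalculusLinear_ofContinuous, hv]
  exact (htop ▸ Submodule.mem_top : f ∈ V)

theorem baireCalculus_injective : Function.Injective (baireCalculus σ) := fun f g h =>
  Linf.ext fun x => by
    rw [← inner_baireCalculus_self hv f x, ← inner_baireCalculus_self hv g x, h]

/-- If all point evaluations are vector functionals, then the range of the Baire functional calculus
is the σ-closure of the continuous functions. -/
theorem range_baireCalculus : Set.range (baireCalculus σ) = sigmaClosure (Set.range σ) := by
  refine (range_baireCalculus_subset σ).antisymm fun b hb => ?_
  refine hb (LinearMap.range (baireCalculusLinear σ)) ?_ ?_ ?_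
  · rintro _ ⟨f, rfl⟩
    exact ⟨Linf.ofContinuous f, baireCalculusLinear_ofContinuous σ f⟩
  · rintro _ ⟨f, rfl⟩
    exact ⟨star f, baireCalculusLinear_star σ f⟩
  · intro a s ha h
    choose f hf using ha
    -- Through `v x`, monotonicity of the operators becomes pointwise monotonicity of the functions.
    -- Their supremum in `Linf K` is then mapped to the supremum of the operators.
    have hval : ∀ n x, f n x = ⟪v x, a n (v x)⟫_ℂ := fun n x => by
      rw [← hf n]
      exact (inner_baireCalculus_self hv (f n) x).symm
    have hsa : ∀ n, IsSelfAdjoint (f n) := fun n => baireCalculus_injective hv (by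
      rw [map_star]
      change star (baireCalculusLinear σ (f n)) = baireCalculusLinear σ (f n)
      rw [hf]
      exact (h.isSelfAdjoint n).star_eq)
    have hmono : Monotone f := fun i j hij x => by
      rw [hval, hval]
      exact ContinuousLinearMap.le_iff_inner_le.mp (h.monotone hij) (v x)
    obtain ⟨t, ht⟩ := Linf.isSigmaComplete f hsa hmono ⟨‖s - a 0‖ + ‖a 0‖, fun n => by
      rw [← NonUnitalStarAlgHom.norm_map (baireCalculus σ) (baireCalculus_injective hv)]
      change ‖baireCalculusLinear σ (f n)‖ ≤ _
      rw [hf]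
      exact h.norm_le n⟩
    have h1 := baireCalculusLinear_increasesTo σ ht
    simp_rw [hf] at h1
    exact ⟨t, h1.isLUB.unique h.isLUB⟩

end Calculus

/-! ### Compact metrizable spaces and standard Borel spaces -/

section CompactMetrizable

theorem iSup_comap_continuousMap_eq_borel (K : Type u) [TopologicalSpace K]
    [TopologicalSpace.MetrizableSpace K] :
    ⨆ f : C(K, ℝ), (borel ℝ).comap f = borel K := by
  let := TopologicalSpace.metrizableSpaceMetric K
  refine le_antisymm (iSup_le fun f => ?_) (MeasurableSpace.generateFrom_le fun U hU => ?_)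
  · let : MeasurableSpace K := borel K
    have : BorelSpace K := ⟨rfl⟩
    exact f.continuous.measurable.comap_le
  · by_cases hU' : Uᶜ.Nonempty
    · refine MeasurableSpace.measurableSet_iSup.mpr (.basic _ ⟨⟨fun x => Metric.infDist x Uᶜ,
        Metric.continuous_infDist_pt _⟩, {0}ᶜ, (measurableSet_singleton (0 : ℝ)).compl, ?_⟩)
      ext x
      have := (isClosed_compl_iff.mpr (show IsOpen U from hU)).mem_iff_infDist_zero (x := x) hU'
      simp only [Set.mem_preimage, ContinuousMap.coe_mk, Set.mem_compl_iff,
        Set.mem_singleton_iff, ← this]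
      simp
    · rw [Set.not_nonempty_iff_eq_empty, Set.compl_empty_iff] at hU'
      rw [hU']
      exact MeasurableSet.univ

theorem borelSpace_of_baireMeasurable (K : Type u) [TopologicalSpace K]
    [TopologicalSpace.MetrizableSpace K] [MeasurableSpace K] [BaireMeasurable K] : BorelSpace K :=
  ⟨(BaireMeasurable.eq_iSup (K := K)).trans (iSup_comap_continuousMap_eq_borel K)⟩

theorem baireMeasurable_of_borelSpace (K : Type u) [TopologicalSpace K]
    [TopologicalSpace.MetrizableSpace K] [MeasurableSpace K] [BorelSpace K] : BaireMeasurable K :=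
  ⟨(BorelSpace.measurable_eq (α := K)).trans (iSup_comap_continuousMap_eq_borel K).symm⟩

theorem standardBorelSpace_of_compact_metrizable (K : Type u) [TopologicalSpace K] [CompactSpace K]
    [TopologicalSpace.MetrizableSpace K] [MeasurableSpace K] [BorelSpace K] :
    StandardBorelSpace K := by
  let := TopologicalSpace.metrizableSpaceMetric K
  infer_instance

theorem ContinuousMap.exists_apply_ne {K : Type u} [TopologicalSpace K] [CompactSpace K] [T2Space K]
    {x y : K} (h : x ≠ y) : ∃ f : C(K, ℂ), f x ≠ f y := by
  by_contra! hf
  exact h ((WeakDual.CharacterSpace.continuousMapEval_bijective (X := K) (𝕜 := ℂ)).1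
    (Subtype.ext (DFunLike.ext _ _ hf)))

/-- A dense sequence in C(K) separates points, since two points it fails to separate would be
identified by all continuous functions. Compactness makes the resulting injection into ℕ → ℂ an
embedding. -/
theorem metrizableSpace_of_separableSpace_continuousMap (K : Type u) [TopologicalSpace K]
    [CompactSpace K] [T2Space K] [TopologicalSpace.SeparableSpace C(K, ℂ)] :
    TopologicalSpace.MetrizableSpace K := by
  let F : K → ℕ → ℂ := fun x n => TopologicalSpace.denseSeq C(K, ℂ) n x
  have hF : Continuous F := continuous_pi fun n => (TopologicalSpace.denseSeq C(K, ℂ) n).continuous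
  have hinj : Function.Injective F := by
    intro x y hxy
    by_contra hne
    obtain ⟨f, hf⟩ := ContinuousMap.exists_apply_ne hne
    have hclosed : IsClosed {f : C(K, ℂ) | f x = f y} :=
      isClosed_eq (continuous_eval_const x) (continuous_eval_const y)
    have hdense := (TopologicalSpace.denseRange_denseSeq C(K, ℂ)).closure_eq
    have hsub : Set.range (TopologicalSpace.denseSeq C(K, ℂ)) ⊆ {f : C(K, ℂ) | f x = f y} := by
      rintro _ ⟨n, rfl⟩
      exact congrFun hxy n
    have := hclosed.closure_subset_iff.mpr hsub
    rw [hdense] at this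
    exact hf (this (Set.mem_univ f))
  exact (hF.isClosedEmbedding hinj).isEmbedding.metrizableSpace

/-- A measurable space is the Borel space of a compact metrizable topology. -/
def IsCompactMetrizableBorel (X : Type u) [MeasurableSpace X] : Prop :=
  ∃ _ : TopologicalSpace X, CompactSpace X ∧ TopologicalSpace.MetrizableSpace X ∧ BorelSpace X

theorem IsCompactMetrizableBorel.of_measurableEquiv {X : Type u} {K : Type v} [MeasurableSpace X]
    [MeasurableSpace K] (e : X ≃ᵐ K) (h : IsCompactMetrizableBorel K) :
    IsCompactMetrizableBorel X := by
  obtain ⟨_, _, _, hK⟩ := h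
  let : TopologicalSpace X := TopologicalSpace.induced e inferInstance
  let g : X ≃ₜ K := e.toEquiv.toHomeomorphOfIsInducing ⟨rfl⟩
  refine ⟨_, g.symm.compactSpace, g.isEmbedding.metrizableSpace, ⟨?_⟩⟩
  exact e.measurableEmbedding.comap_eq.symm.trans
    ((congrArg (MeasurableSpace.comap (e : X → K)) hK.measurable_eq).trans borel_comap.symm)

theorem IsCompactMetrizableBorel.standardBorelSpace {X : Type u} [MeasurableSpace X]
    (h : IsCompactMetrizableBorel X) : StandardBorelSpace X := by
  obtain ⟨_, _, _, _⟩ := h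
  exact standardBorelSpace_of_compact_metrizable X

/-- Every standard Borel space is the Borel space of a compact metrizable topology. -/
theorem StandardBorelSpace.isCompactMetrizableBorel (X : Type u) [MeasurableSpace X]
    [StandardBorelSpace X] : IsCompactMetrizableBorel X := by
  by_cases hc : Countable X
  · rcases finite_or_infinite X with hfin | hinf
    · let : TopologicalSpace X := ⊥
      have : DiscreteTopology X := ⟨rfl⟩
      exact ⟨_, inferInstance, inferInstance, inferInstance⟩
    -- A convergent sequence with its limit is a compact countable infinite model; on countable
    -- spaces with measurable singletons any bijection is a measurable equivalence.
    · let S : Set ℝ := insert 0 (Set.range fun n : ℕ => 1 / ((n : ℝ) + 1))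
      have hS : IsCompact S := tendsto_one_div_add_atTop_nhds_zero_nat.isCompact_insert_range
      have : CompactSpace S := isCompact_iff_compactSpace.mp hS
      have : Countable S := ((Set.countable_range _).insert 0).to_subtype
      have : Infinite S := by
        refine Set.Infinite.to_subtype (Set.Infinite.mono (Set.subset_insert _ _) ?_)
        refine Set.infinite_range_of_injective fun m n hmn => ?_
        have : (m : ℝ) + 1 = n + 1 := by simpa using hmn
        exact_mod_cast add_right_cancel this
      obtain ⟨e⟩ := nonempty_equiv_of_countable (α := X) (β := S)
      exact IsCompactMetrizableBorel.of_measurableEquiv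
        (K := S) ⟨e, measurable_of_countable _, measurable_of_countable _⟩
        ⟨inferInstance, inferInstance, inferInstance, inferInstance⟩
  -- An uncountable standard Borel space is Borel isomorphic to the Cantor space ℕ → Bool.
  · exact IsCompactMetrizableBorel.of_measurableEquiv
      (PolishSpace.measurableEquivNatBoolOfNotCountable hc)
      ⟨inferInstance, inferInstance, inferInstance, inferInstance⟩

end CompactMetrizable

theorem IsBaireMeasurableSpace.of_measurableEquiv {X K : Type u} [MeasurableSpace X]
    [MeasurableSpace K] (e : X ≃ᵐ K) (h : IsBaireMeasurableSpace K) :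
    IsBaireMeasurableSpace X := by
  obtain ⟨_, _, _, hK⟩ := h
  let : TopologicalSpace X := TopologicalSpace.induced e inferInstance
  let g : X ≃ₜ K := e.toEquiv.toHomeomorphOfIsInducing ⟨rfl⟩
  refine ⟨_, g.symm.compactSpace, g.symm.t2Space, ?_⟩
  refine e.measurableEmbedding.comap_eq.symm.trans
    ((congrArg (MeasurableSpace.comap (e : X → K)) hK).trans ?_)
  rw [MeasurableSpace.comap_iSup]
  refine le_antisymm (iSup_le fun f => ?_) (iSup_le fun f => ?_)
  · rw [MeasurableSpace.comap_comp]
    exact le_iSup (fun f : C(X, ℝ) => (borel ℝ).comap f) (f.comp g)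
  · refine le_iSup_of_le (f.comp (g.symm : C(K, X))) ?_
    rw [MeasurableSpace.comap_comp]
    refine le_of_eq (congrArg (fun F => (borel ℝ).comap F) (funext fun x => ?_))
    exact congrArg f (g.symm_apply_apply x).symm

/-! ### The σ-spectrum of the bounded Baire functions -/

section Spectrum

variable {K : Type u} [TopologicalSpace K] [MeasurableSpace K] [BaireMeasurable K] [CompactSpace K]
  [T2Space K]

/-- A σ-normal character restricts to a character of C(K), hence to evaluation at a point, and
σ-normality propagates this equality to all Baire functions. -/
theorem Linf.evalSpec_bijective : Function.Bijective (Linf.evalSpec (X := K)) := by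
  constructor
  · intro x y h
    by_contra hne
    obtain ⟨f, hf⟩ := ContinuousMap.exists_apply_ne hne
    exact hf (congrArg (fun χ : SigmaSpectrum (Linf K) => χ.1 (Linf.ofContinuous f)) h)
  · intro χ
    let ψ : WeakDual.characterSpace ℂ C(K, ℂ) := WeakDual.CharacterSpace.equivAlgHom.symm
      (χ.1.comp (Linf.ofContinuous (K := K)) : C(K, ℂ) →ₐ[ℂ] ℂ)
    obtain ⟨x, hx⟩ := (WeakDual.CharacterSpace.continuousMapEval_bijective (X := K) (𝕜 := ℂ)).2 ψ
    refine ⟨x, SigmaSpectrum.ext fun a => ?_⟩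
    have := Linf.eq_of_ofContinuous (φ := (Linf.eval x : Linf K →ₐ[ℂ] ℂ).toLinearMap)
      (ψ := (χ.1 : Linf K →ₐ[ℂ] ℂ).toLinearMap) (Linf.isSigmaNormal_eval x) χ.2 fun f =>
        congrArg (fun ψ : WeakDual.characterSpace ℂ C(K, ℂ) => ψ f) hx
    exact LinearMap.congr_fun this a

/-- The Gelfand σ-spectrum of the algebra of bounded Baire functions is the underlying space. -/
def Linf.spectrumEquiv {B : Type u} [CStarAlgebra B] [PartialOrder B] [StarOrderedRing B]
    (e : B ≃⋆ₐ[ℂ] Linf K) : SigmaSpectrum B ≃ᵐ K := by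
  have hbij : Function.Bijective fun x : K => SigmaSpectrum.comap e (Linf.evalSpec x) := by
    refine Function.Bijective.comp (g := SigmaSpectrum.comap e) ⟨fun χ ψ h => ?_, fun χ => ?_⟩ (Linf.evalSpec_bijective (K := K))
    · refine SigmaSpectrum.ext fun a => ?_
      have := congrArg (fun χ : SigmaSpectrum B => χ.1 (e.symm a)) h
      simpa using this
    · exact ⟨SigmaSpectrum.comap e.symm χ, SigmaSpectrum.ext fun a => by simp⟩
  refine MeasurableEquiv.symm ⟨Equiv.ofBijective _ hbij, ?_, ?_⟩
  · refine measurable_iff_comap_le.mpr ?_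
    rw [instMeasurableSpaceSigmaSpectrum, MeasurableSpace.comap_iSup]
    refine iSup_le fun b => ?_
    rw [MeasurableSpace.comap_comp]
    exact (e b).measurable.comap_le
  -- Under the bijection, a continuous real function on `K` becomes the real part of an evaluation
  -- on the spectrum.
  · refine measurable_of_forall_continuousMap fun f => ?_
    have h1 := Complex.measurable_re.comp (SigmaSpectrum.measurable_apply
      (e.symm (Linf.ofContinuous ⟨fun x => (f x : ℂ), by fun_prop⟩)))
    refine (congrArg Measurable (funext fun χ => ?_)).mp h1
    obtain ⟨x, rfl⟩ := hbij.2 χ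
    change _ = f ((Equiv.ofBijective _ hbij).symm (Equiv.ofBijective _ hbij x))
    rw [Equiv.symm_apply_apply]
    change ((SigmaSpectrum.comap e (Linf.evalSpec x)).1 (e.symm _)).re = f x
    rw [SigmaSpectrum.comap_apply, StarAlgEquiv.apply_symm_apply]
    rfl

end Spectrum

/-! ### Commutative Pedersen–Baire envelopes -/

section Envelope

/-- Evaluation at a point of `K` is a state of `A`, hence a vector state of the universal
representation. These vectors are what `range_baireCalculus` asks for. -/
theorem isPedersenBaireEnvelope_linf {A : Type u} [CStarAlgebra A] [PartialOrder A]
    [StarOrderedRing A] {K : Type u} [TopologicalSpace K] [MeasurableSpace K] [BaireMeasurable K]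
    [CompactSpace K] [T2Space K] (ρ : A ≃⋆ₐ[ℂ] C(K, ℂ)) : IsPedersenBaireEnvelope A (Linf K) := by
  let σ : C(K, ℂ) →⋆ₐ[ℂ] (UnivHilbert A →L[ℂ] UnivHilbert A) :=
    (universalRep A).comp (ρ.symm : C(K, ℂ) →⋆ₐ[ℂ] A)
  have hv : ∀ x : K, ∃ v : UnivHilbert A, ∀ f : C(K, ℂ), inner ℂ v (σ f v) = f x := fun x => by
    let φ : A →ₚ[ℂ] ℂ := PositiveLinearMap.mk₀
      ((Linf.eval x : Linf K →ₐ[ℂ] ℂ).toLinearMap ∘ₗ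
        (Linf.ofContinuous (K := K) : C(K, ℂ) →ₐ[ℂ] Linf K).toLinearMap ∘ₗ
        ((ρ : A →⋆ₐ[ℂ] C(K, ℂ)) : A →ₐ[ℂ] C(K, ℂ)).toLinearMap) fun a ha =>
          (map_nonneg (ρ : A →⋆ₐ[ℂ] C(K, ℂ)) ha : 0 ≤ ρ a) x
    have hφ : ∀ a, φ a = ρ a x := fun a => rfl
    obtain ⟨v, hv⟩ := exists_inner_universalRep φ (by rw [hφ, map_one]; rfl)
    refine ⟨v, fun f => (hv (ρ.symm f)).trans ?_⟩
    rw [hφ, StarAlgEquiv.apply_symm_apply]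
  choose v hv using hv
  refine ⟨baireCalculus σ, baireCalculus_injective hv, ?_⟩
  rw [range_baireCalculus hv]
  congr 1
  exact ρ.symm.surjective.range_comp (universalRep A)

theorem StarAlgHom.nonempty_equiv_of_range_eq {A B C : Type*} [CStarAlgebra A] [CStarAlgebra B]
    [CStarAlgebra C] {φ : A →⋆ₐ[ℂ] C} {ψ : B →⋆ₐ[ℂ] C} (hφ : Function.Injective φ)
    (hψ : Function.Injective ψ) (hr : Set.range φ = Set.range ψ) : Nonempty (A ≃⋆ₐ[ℂ] B) := by
  have h : φ.range = ψ.range := SetLike.coe_injective hr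
  have e : Nonempty (A ≃⋆ₐ[ℂ] ψ.range) := h ▸ ⟨StarAlgEquiv.ofInjective φ hφ⟩
  exact e.map fun e => e.trans (StarAlgEquiv.ofInjective ψ hψ).symm

/-- The Pedersen–Baire envelope is unique up to isomorphism. -/
theorem IsPedersenBaireEnvelope.nonempty_equiv {A : Type u} [CStarAlgebra A] [PartialOrder A]
    [StarOrderedRing A] {B C : Type u} [CStarAlgebra B] [CStarAlgebra C]
    (hB : IsPedersenBaireEnvelope A B) (hC : IsPedersenBaireEnvelope A C) :
    Nonempty (B ≃⋆ₐ[ℂ] C) := by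
  obtain ⟨ι, hι, hr⟩ := hB
  obtain ⟨κ, hκ, hs⟩ := hC
  exact StarAlgHom.nonempty_equiv_of_range_eq (C := UnivHilbert A →L[ℂ] UnivHilbert A)
    (φ := ι) (ψ := κ) hι hκ (hr.trans hs.symm)

theorem exists_equiv_continuousMap (A : Type u) [inst : CStarAlgebra A]
    (hcomm : ∀ a b : A, a * b = b * a) :
    ∃ (K : Type u) (_ : TopologicalSpace K) (_ : CompactSpace K) (_ : T2Space K),
      Nonempty (A ≃⋆ₐ[ℂ] C(K, ℂ)) := by
  let : CommCStarAlgebra A := { inst with mul_comm := hcomm }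
  exact ⟨WeakDual.characterSpace ℂ A, inferInstance, inferInstance, inferInstance,
    ⟨gelfandStarTransform A⟩⟩

/-- `A` embeds in its commutative envelope, so it is commutative and Gelfand duality supplies `K`.
Uniqueness of the envelope then identifies `B` with the Baire functions on `K`. -/
theorem exists_equiv_linf_of_envelope {A B : Type u} [CStarAlgebra A] [PartialOrder A]
    [StarOrderedRing A] [CommCStarAlgebra B] (h : IsPedersenBaireEnvelope A B) :
    ∃ (K : Type u) (_ : TopologicalSpace K) (_ : MeasurableSpace K) (_ : BaireMeasurable K)
      (_ : CompactSpace K) (_ : T2Space K), Nonempty (A ≃⋆ₐ[ℂ] C(K, ℂ)) ∧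
        Nonempty (B ≃⋆ₐ[ℂ] Linf K) := by
  have hcomm : ∀ a b : A, a * b = b * a := by
    obtain ⟨ι, hι, hr⟩ := h
    have hsub : ∀ a, ∃ b, ι b = universalRep A a := fun a => by
      change universalRep A a ∈ Set.range ι
      rw [hr]
      exact fun V hV _ _ => hV ⟨a, rfl⟩
    intro a b
    obtain ⟨a', ha⟩ := hsub a
    obtain ⟨b', hb⟩ := hsub b
    refine universalRep_injective ?_
    rw [map_mul, map_mul, ← ha, ← hb, ← map_mul, ← map_mul, mul_comm]
  obtain ⟨K, _, _, _, ⟨ρ⟩⟩ := exists_equiv_continuousMap A hcomm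
  let : MeasurableSpace K := ⨆ f : C(K, ℝ), (borel ℝ).comap f
  have : BaireMeasurable K := ⟨rfl⟩
  exact ⟨K, _, _, inferInstance, inferInstance, inferInstance, ⟨ρ⟩,
    h.nonempty_equiv (isPedersenBaireEnvelope_linf ρ)⟩

theorem isPedersenBaireEnvelope_continuousMap (K : Type u) [TopologicalSpace K] [MeasurableSpace K]
    [BaireMeasurable K] [CompactSpace K] [T2Space K] : IsPedersenBaireEnvelope C(K, ℂ) (Linf K) :=
  isPedersenBaireEnvelope_linf (.refl ..)

end Envelope

/-! ### Object-level checks for the restricted dualities -/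

namespace CommSigmaCStar

theorem isPedBaireSep_le_isPedBaire : isPedBaireSep.{u} ≤ isPedBaire := by
  rintro B ⟨A, i₁, i₂, i₃, -, h⟩
  exact ⟨A, i₁, i₂, i₃, h⟩

theorem isPedBaire_le_isPure : isPedBaire.{u} ≤ isPure := by
  rintro B ⟨A, _, _, _, h⟩
  obtain ⟨K, _, _, _, _, _, -, ⟨e⟩⟩ := exists_equiv_linf_of_envelope h
  exact (Linf.isPurelySigmaRepresentable K).of_equiv e

theorem isBaire_specStoch {B : CommSigmaCStar.{u}} (hB : isPedBaire B) : isBaire (specStoch B) := by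
  obtain ⟨A, _, _, _, h⟩ := hB
  obtain ⟨K, _, _, hK, _, _, -, ⟨e⟩⟩ := exists_equiv_linf_of_envelope h
  exact IsBaireMeasurableSpace.of_measurableEquiv (Linf.spectrumEquiv e)
    ⟨_, inferInstance, inferInstance, hK.eq_iSup⟩

/-- Separability passes from `A` to C(K), which makes `K` metrizable; its Baire σ-algebra is then
Borel, and the spectrum is measurably equivalent to `K`. -/
theorem isStandardBorel_specStoch {B : CommSigmaCStar.{u}} (hB : isPedBaireSep B) :
    isStandardBorel (specStoch B) := by
  obtain ⟨A, _, _, _, _, h⟩ := hB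
  obtain ⟨K, _, _, hK, _, _, ⟨ρ⟩, ⟨e⟩⟩ := exists_equiv_linf_of_envelope h
  have hρ : Continuous ρ := map_continuous (ρ : A →⋆ₐ[ℂ] C(K, ℂ))
  have : TopologicalSpace.SeparableSpace C(K, ℂ) := ρ.surjective.denseRange.separableSpace hρ
  have := metrizableSpace_of_separableSpace_continuousMap K
  have := borelSpace_of_baireMeasurable K
  exact (IsCompactMetrizableBorel.of_measurableEquiv (Linf.spectrumEquiv e)
    ⟨_, inferInstance, inferInstance, inferInstance⟩).standardBorelSpace

theorem isPedBaire_koopman {X : Stoch.{u}} (hX : isBaire X) : isPedBaire (koopman.obj (.op X)) := by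
  obtain ⟨_, _, _, h⟩ := hX
  have : BaireMeasurable X.obj := ⟨h⟩
  exact ⟨C(X.obj, ℂ), _, _, inferInstance, isPedersenBaireEnvelope_continuousMap X.obj⟩

theorem isPedBaireSep_koopman {X : Stoch.{u}} (hX : isStandardBorel X) :
    isPedBaireSep (koopman.obj (.op X)) := by
  have : StandardBorelSpace X.obj := hX
  obtain ⟨_, _, _, _⟩ := StandardBorelSpace.isCompactMetrizableBorel X.obj
  have := baireMeasurable_of_borelSpace X.obj
  let := TopologicalSpace.metrizableSpaceMetric X.obj
  exact ⟨C(X.obj, ℂ), _, _, inferInstance, inferInstance,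
    isPedersenBaireEnvelope_continuousMap X.obj⟩

end CommSigmaCStar

end

theorem proposition4p34 :
    (koopman.{u}.Full ∧ koopman.{u}.Faithful) ∧
    ∃ (hL : ∀ X : Stoch.{u}ᵒᵖ, CommSigmaCStar.isPure (koopman.obj X)) (S : SpecAction.{u}),
      (∃ e : Stoch.{u}ᵒᵖ ≌ CommSigmaCStar.isPure.{u}.FullSubcategory,
        e.functor = CommSigmaCStar.isPure.lift koopman hL ∧ e.inverse = S.functor.rightOp) ∧
      RestrictsToDuality isBaire CommSigmaCStar.isPedBaire S ∧
      RestrictsToDuality isStandardBorel CommSigmaCStar.isPedBaireSep S :=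
  ⟨⟨inferInstance, inferInstance⟩, isPure_koopman, specAction, exists_duality,
    restrictsToDuality _ _ CommSigmaCStar.isPedBaire_le_isPure
      (fun _ => CommSigmaCStar.isPedBaire_koopman) fun _ => CommSigmaCStar.isBaire_specStoch,
    restrictsToDuality _ _
      (CommSigmaCStar.isPedBaireSep_le_isPedBaire.trans CommSigmaCStar.isPedBaire_le_isPure)
      (fun _ => CommSigmaCStar.isPedBaireSep_koopman)
      fun _ => CommSigmaCStar.isStandardBorel_specStoch⟩
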